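/- **Setting.** Let $Q=\{1,\dots,N\}$, $N\ge 1$, fix an initial state $q_0\in Q$, and let $\theta\in\mathbb N^{N\times N}$ with all $\theta_{ij}\ge 1$. The unknown transition matrix $M$ of a Markov chain on $Q$ started at $q_0$ has the matrix beta prior with density $$p_\theta(M)=\prod_{i}\frac{\Gamma(\sum_j\theta_{ij})}{\prod_j\Gamma(\theta_{ij})}\prod_{i,j}M_{ij}^{\theta_{ij}-1}$$ with respect to Lebesgue measure on the stochastic $N\times N$ matrices (each row parametrized by $N-1$ of its coordinates). For a word $\vec x=x_0\dots x_m$ with $x_0=q_0$, the posterior $\mathbb P_\theta(\cdot\mid\vec x)$ has, by Bayes' rule, density proportional to $p_\theta(M)\prod_{t<m}M_{x_tx_{t+1}}$. A path of a Markov chain is a nonempty word $x_0\dots x_m$ with $\mathbb P(X_t=x_t)>0$ for every $t$. An expression $\varphi$ is generated by $\xi::=v_{ij}\mid\xi\cdot\xi\mid 1\div\xi$ and $\varphi::=\kappa\in\mathbb R\mid\xi\mid\varphi+\varphi\mid\varphi-\varphi\mid\varphi\cdot\varphi$; $\varphi(M)$ is its value at $v_{ij}=M_{ij}$. Expanding $\varphi$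 gives its polynomial form $\sum_l\kappa_l\prod_{i,j}v_{ij}^{d^l_{ij}}$ with $d^l_{ij}\in\mathbb Z$. Let $0<\delta\le 1$. A *monitor* is a randomized register monitor: it has finitely many registers holding natural numbers, all $0$ at the start; on each input symbol it selects the unique applicable test (a conjunction of atomic formulas and negations over $0,1,+,-,\times,\div,\le,=$ in the registers), draws at random an update (an assignment of terms over $0,1,+,-,\times,\div$ to the registers) and performs it; its output is a function of the registers, here a real interval or $\bot$ ("no estimate yet", which excludes no value). It *solves the Bayesian monitoring problem* for $(Q,\varphi,\delta)$ if for every Markov chain on $Q$ started at $q_0$ and every finite path $\vec x$ of it, its output on $\vec x$ contains $\varphi(M)$ with probability at least $1-\delta$ given $\vec x$, jointly over the posterior of $M$ and the monitor's own independent randomness. **The algorithm.** For a polynomial form with exponents $d^l$ put $d^l_i=\sum_jd^l_{ij}$. BayesExpMonitor initializes on the first symbol counters $\bar c_{ij}=\theta_{ij}$, $\bar c_i=\sum_j\theta_{ij}$ and is inactive. On each further symbol $\sigma'$ with previous state $\sigma$ it increments $\bar c_{\sigma\sigma'}$ and $\bar c_\sigma$. If it is inactive and $\bar c_{ij}+\min_l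 d^l_{ij}>0$ for every variable $v_{ij}$ that occurs, it becomes active and sets, for each $l$, $$h^l=\frac{\prod_i\prod_{j:\,d^l_{ij}>0}P(\bar c_{ij}-1+|d^l_{ij}|,|d^l_{ij}|)}{\prod_{i:\,d^l_i>0}P(\bar c_i-1+|d^l_i|,|d^l_i|)}\cdot\frac{\prod_{i:\,d^l_i<0}P(\bar c_i-1,|d^l_i|)}{\prod_i\prod_{j:\,d^l_{ij}<0}P(\bar c_{ij}-1,|d^l_{ij}|)},\qquad P(a,k)=\frac{a!}{(a-k)!};$$ if it was active before, it multiplies $h^l$ by $\frac{\bar c_{\sigma\sigma'}-1+d^l_{\sigma\sigma'}}{\bar c_{\sigma\sigma'}-1}\cdot\frac{\bar c_\sigma-1}{\bar c_\sigma-1+d^l_\sigma}$. Its value is $\sum_l\kappa_lh^l$ if active and $\bot$ otherwise. BayesConfIntMonitor runs it on the polynomial forms of $\varphi$ and of $\varphi^2=\varphi\cdot\varphi$ in parallel; with values $E$, $E_2$ its output is $[E\pm\sqrt{(E_2-E^2)/\delta}]$, or $\bot$ if one of them is $\bot$. **Theorem.** The prior is a probability measure, and BayesConfIntMonitor is a register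 monitor that solves the Bayesian monitoring problem for $(Q,\varphi,\delta)$ with this prior. More precisely, let $\vec x$ be a finite path of a Markov chain on $Q$ started at $q_0$, and let $c_{ij}(\vec x)$ be the number of transitions from $i$ to $j$ in $\vec x$. The posterior given $\vec x$ is a probability measure. If $\vec x$ has at least one transition and $c_{ij}(\vec x)+\theta_{ij}+d_{ij}>0$ for all $i,j$ and for the exponents $d$ of every monomial in the polynomial forms of $\varphi$ and of $\varphi^2$, then $\varphi(M)$ is square-integrable under the posterior, the output of the monitor on $\vec x$ is, with probability one, the interval $$\Big[E-\sqrt{V/\delta},\ E+\sqrt{V/\delta}\Big],\qquad E=\mathbb E_\theta(\varphi(M)\mid\vec x),\quad V=\mathrm{Var}_\theta(\varphi(M)\mid\vec x),$$ and $\mathbb P_\theta\big(\varphi(M)\in[E-\sqrt{V/\delta},E+\sqrt{V/\delta}]\mid\vec x\big)\ge 1-\delta$. Otherwise the output is $\bot$. -/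

import Mathlib

open MeasureTheory ProbabilityTheory

open scoped ENNReal

namespace BayesMonitor

/-! ### Finite Markov chains -/

/-- A finite Markov chain with states `Fin N`: a transition matrix whose rows lie in the
probability simplex, and a distribution of the initial state. -/
structure MarkovChain (N : ℕ) where
  trans : Matrix (Fin N) (Fin N) ℝ
  trans_mem : ∀ i, trans i ∈ stdSimplex ℝ (Fin N)
  init : Fin N → ℝ
  init_mem : init ∈ stdSimplex ℝ (Fin N)

/-- `C.marginal t j` is the probability of `X_t = j`. -/
noncomputable def MarkovChain.marginal {N : ℕ} (C : MarkovChain N) (t : ℕ) : Fin N → ℝ :=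
  Matrix.vecMul C.init (C.trans ^ t)

/-- A finite path of the chain: a word `x_0 … x_m` with `P(X_t = x_t) > 0` for every `t`. -/
def MarkovChain.IsPath {N : ℕ} (C : MarkovChain N) (x : List (Fin N)) : Prop :=
  x ≠ [] ∧ ∀ (t : ℕ) (h : t < x.length), 0 < C.marginal t x[t]

/-- The chain starts in the state `q₀` almost surely. -/
def MarkovChain.StartsAt {N : ℕ} (C : MarkovChain N) (q₀ : Fin N) : Prop :=
  C.init = Pi.single q₀ 1

/-! ### Probabilistic specification expressions -/

/-- `ξ ::= v_{ij} | ξ · ξ | 1 ÷ ξ` -/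
inductive Monomial (Q : Type) : Type
  | var (i j : Q) : Monomial Q
  | mul (ξ η : Monomial Q) : Monomial Q
  | inv (ξ : Monomial Q) : Monomial Q

/-- `φ ::= κ | ξ | φ + φ | φ - φ | φ · φ` -/
inductive PSE (Q : Type) : Type
  | const (κ : ℝ) : PSE Q
  | mono (ξ : Monomial Q) : PSE Q
  | add (φ ψ : PSE Q) : PSE Q
  | sub (φ ψ : PSE Q) : PSE Q
  | mul (φ ψ : PSE Q) : PSE Q

noncomputable def Monomial.eval {Q : Type} : Monomial Q → (Q → Q → ℝ) → ℝ
  | .var i j, M => M i j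
  | .mul ξ η, M => ξ.eval M * η.eval M
  | .inv ξ, M => 1 / ξ.eval M

/-- The value `φ(M)`. -/
noncomputable def PSE.eval {Q : Type} : PSE Q → (Q → Q → ℝ) → ℝ
  | .const κ, _ => κ
  | .mono ξ, M => ξ.eval M
  | .add φ ψ, M => φ.eval M + ψ.eval M
  | .sub φ ψ, M => φ.eval M - ψ.eval M
  | .mul φ ψ, M => φ.eval M * ψ.eval M

/-- The integer exponent `d_{ab}` of the variable `v_{ab}` in a monomial. -/
def Monomial.exponent {Q : Type} [DecidableEq Q] : Monomial Q → Q → Q → ℤ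
  | .var i j, a, b => if a = i ∧ b = j then 1 else 0
  | .mul ξ η, a, b => ξ.exponent a b + η.exponent a b
  | .inv ξ, a, b => - ξ.exponent a b

/-- An expression in polynomial form `∑_l κ_l ξ_l`, as the list of the pairs of the weight `κ_l`
and the exponent matrix `d^l` of `ξ_l`. -/
abbrev PolyForm (Q : Type) : Type := List (ℝ × (Q → Q → ℤ))

/-- The polynomial form of an expression, obtained by expanding sums, differences and products
from the leaves upwards. -/
noncomputable def PSE.polyForm {Q : Type} [DecidableEq Q] : PSE Q → PolyForm Q
  | .const κ => [(κ, fun _ _ => 0)]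
  | .mono ξ => [(1, ξ.exponent)]
  | .add φ ψ => φ.polyForm ++ ψ.polyForm
  | .sub φ ψ => φ.polyForm ++ ψ.polyForm.map (fun s => (-s.1, s.2))
  | .mul φ ψ =>
      φ.polyForm.flatMap fun s => ψ.polyForm.map fun t =>
        (s.1 * t.1, fun i j => s.2 i j + t.2 i j)

/-! ### Matrix beta prior and Bayesian posterior -/

/-- Lebesgue measure on the simplex `Δ(n) ⊆ ℝ^{n+1}`, parametrized by all coordinates
but the first one. -/
noncomputable def simplexVolume (n : ℕ) : Measure (Fin (n + 1) → ℝ) :=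
  ((volume : Measure (Fin n → ℝ)).restrict {y | (∀ i, 0 ≤ y i) ∧ ∑ i, y i ≤ 1}).map
    (fun y => (Fin.cons (1 - ∑ i, y i) y : Fin (n + 1) → ℝ))

/-- Lebesgue measure `dM` on `Δ(n)^{n+1}`, the set of stochastic matrices with `n + 1` states. -/
noncomputable def stochVolume (n : ℕ) : Measure (Fin (n + 1) → Fin (n + 1) → ℝ) :=
  Measure.pi fun _ => simplexVolume n

/-- The matrix beta density
`∏_i (Γ(∑_j θ_{ij}) / ∏_j Γ(θ_{ij})) · ∏_{i,j} M_{ij} ^ (θ_{ij} - 1)`,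
for a parameter matrix of positive integers. -/
noncomputable def matrixBetaDensity {n : ℕ} (θ : Fin (n + 1) → Fin (n + 1) → ℕ)
    (M : Fin (n + 1) → Fin (n + 1) → ℝ) : ℝ :=
  (∏ i, (Real.Gamma (∑ j, (θ i j : ℝ)) / ∏ j, Real.Gamma (θ i j : ℝ))) *
    ∏ i, ∏ j, M i j ^ (θ i j - 1)

/-- The prior: the matrix beta distribution with parameter `θ`. -/
noncomputable def matrixBeta {n : ℕ} (θ : Fin (n + 1) → Fin (n + 1) → ℕ) :
    Measure (Fin (n + 1) → Fin (n + 1) → ℝ) :=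
  (stochVolume n).withDensity fun M => ENNReal.ofReal (matrixBetaDensity θ M)

/-- The product of the transition probabilities along a word. -/
noncomputable def transProd {Q : Type} (M : Q → Q → ℝ) : List Q → ℝ
  | a :: b :: w => M a b * transProd M (b :: w)
  | _ => 1

/-- The probability `P(x ∣ M)` that the chain with transition matrix `M` and initial state `q₀`
starts with the word `x`. -/
noncomputable def pathProb {Q : Type} [DecidableEq Q] (q₀ : Q) (M : Q → Q → ℝ) : List Q → ℝ
  | [] => 1
  | a :: w => if a = q₀ then transProd M (a :: w) else 0

/-- The posterior distribution of the transition matrix given the observed word `x`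
by Bayes' rule: its density with respect to the prior `μ` is
`P(x ∣ M) / ∫ P(x ∣ M') dμ(M')`. -/
noncomputable def posterior {n : ℕ} (μ : Measure (Fin (n + 1) → Fin (n + 1) → ℝ))
    (q₀ : Fin (n + 1)) (x : List (Fin (n + 1))) : Measure (Fin (n + 1) → Fin (n + 1) → ℝ) :=
  μ.withDensity fun M =>
    ENNReal.ofReal (pathProb q₀ M x) / ∫⁻ M', ENNReal.ofReal (pathProb q₀ M' x) ∂μ

/-! ### Randomized register monitors -/

/-- Terms over the signature `⟨0, 1, +, -, ×, ÷⟩` with variables in `R`. -/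
inductive Term (R : Type) : Type
  | zero : Term R
  | one : Term R
  | reg (r : R) : Term R
  | add (s t : Term R) : Term R
  | sub (s t : Term R) : Term R
  | mul (s t : Term R) : Term R
  | div (s t : Term R) : Term R

/-- The value of a term under a valuation of the registers (which hold natural numbers:
subtraction is truncated and division rounds down). -/
def Term.eval {R : Type} (v : R → ℕ) : Term R → ℕ
  | .zero => 0
  | .one => 1
  | .reg r => v r
  | .add s t => s.eval v + t.eval v
  | .sub s t => s.eval v - t.eval v
  | .mul s t => s.eval v * t.eval v
  | .div s t => s.eval v / t.eval v

/-- Atomic formulas. -/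
inductive Atom (R : Type) : Type
  | le (s t : Term R) : Atom R
  | eq (s t : Term R) : Atom R

def Atom.Holds {R : Type} (v : R → ℕ) : Atom R → Prop
  | .le s t => s.eval v ≤ t.eval v
  | .eq s t => s.eval v = t.eval v

/-- A test is a conjunction of atomic formulas (marked `true`) and negated atomic formulas
(marked `false`). -/
abbrev Test (R : Type) : Type := List (Bool × Atom R)

def Test.Holds {R : Type} (v : R → ℕ) (τ : Test R) : Prop :=
  ∀ l ∈ τ, (l.1 = true ↔ l.2.Holds v)

/-- An update assigns a term to every register. -/
abbrev Update (R : Type) : Type := R → Term R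

def Update.apply {R : Type} (γ : Update R) (v : R → ℕ) : R → ℕ := fun r => (γ r).eval v

/-- A randomized register monitor with input alphabet `S` and output alphabet `L`. The transition
function is partial; for each input symbol and valuation exactly one test that holds
is in its domain. -/
structure RegisterMonitor (S L : Type) where
  R : Type
  finite : Finite R
  out : (R → ℕ) → L
  trans : S → Test R → Option (PMF (Update R))
  unique : ∀ (s : S) (v : R → ℕ), ∃! τ : Test R, Test.Holds v τ ∧ (trans s τ).isSome = true

namespace RegisterMonitor

variable {S L : Type}

/-- The distribution of the next valuation after reading `s` at the valuation `v`. -/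
noncomputable def step (A : RegisterMonitor S L) (s : S) (v : A.R → ℕ) : PMF (A.R → ℕ) :=
  ((A.trans s (A.unique s v).choose).get (A.unique s v).choose_spec.1.2).map
    fun γ => Update.apply γ v

/-- The distribution of the last valuation of a run on a word. -/
noncomputable def run (A : RegisterMonitor S L) : List S → (A.R → ℕ) → PMF (A.R → ℕ)
  | [], v => PMF.pure v
  | s :: w, v => (A.step s v).bind (run A w)

/-- The semantics `⟦A⟧(w)`: the distribution of the output after reading `w`, all registers being
`0` at the start. -/
noncomputable def semantics (A : RegisterMonitor S L) (w : List S) : PMF L :=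
  (A.run w fun _ => 0).map A.out

end RegisterMonitor

/-! ### The Bayesian monitoring problem -/

/-- The output alphabet: `some (l, u)` is the interval `[l, u]`, and `none` is the symbol `⊥`
(no estimate yet). -/
abbrev Verdict : Type := Option (ℝ × ℝ)

/-- The values that a verdict admits. The symbol `⊥` excludes no value. -/
def Verdict.toSet : Verdict → Set ℝ
  | none => Set.univ
  | some I => Set.Icc I.1 I.2

/-- The probability that `φ(M) ∈ ⟦A⟧(x)` given `x`, where `M` has the posterior distribution for
the prior `μ` and the monitor draws its random updates independently of `M`. -/
noncomputable def coverProb {n : ℕ} (μ : Measure (Fin (n + 1) → Fin (n + 1) → ℝ))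
    (q₀ : Fin (n + 1)) (φ : PSE (Fin (n + 1)))
    (A : RegisterMonitor (Fin (n + 1)) Verdict) (x : List (Fin (n + 1))) : ℝ≥0∞ :=
  ∑' I : Verdict, A.semantics x I * posterior μ q₀ x {M | φ.eval M ∈ I.toSet}

/-- `A` solves the Bayesian monitoring problem for `φ`, `δ`, the prior `μ` on the transition
matrix and the fixed initial state `q₀`. -/
def SolvesBayesianMonitoring {n : ℕ} (μ : Measure (Fin (n + 1) → Fin (n + 1) → ℝ))
    (q₀ : Fin (n + 1)) (φ : PSE (Fin (n + 1))) (δ : ℝ)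
    (A : RegisterMonitor (Fin (n + 1)) Verdict) : Prop :=
  ∀ C : MarkovChain (n + 1), C.StartsAt q₀ → ∀ x : List (Fin (n + 1)), C.IsPath x →
    ENNReal.ofReal (1 - δ) ≤ coverProb μ q₀ φ A x

/-! ### Deterministic monitors given by a decision table -/

/-- The test which says that each atom `at_ k` has the truth value `b k`. -/
noncomputable def tableTest {R ι : Type} [Fintype ι] (at_ : ι → Atom R) (b : ι → Bool) : Test R :=
  (Finset.univ : Finset ι).toList.map fun k => (b k, at_ k)

theorem tableTest_holds {R ι : Type} [Fintype ι] (at_ : ι → Atom R) (b : ι → Bool) (v : R → ℕ) :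
    Test.Holds v (tableTest at_ b) ↔ ∀ k, (b k = true ↔ (at_ k).Holds v) := by
  simp [Test.Holds, tableTest]

open Classical in
/-- The deterministic monitor that evaluates, on the input symbol `s`, finitely many atomic
formulas `at_ s k`, and performs the update `upd s b`, where `b` are their truth values. -/
noncomputable def tableMonitor {S L R ι : Type} [Finite R] [Fintype ι] (out : (R → ℕ) → L)
    (at_ : S → ι → Atom R) (upd : S → (ι → Bool) → Update R) : RegisterMonitor S L where
  R := R
  finite := inferInstance
  out := out
  trans s τ :=
    if h : ∃ b, τ = tableTest (at_ s) b then some (PMF.pure (upd s h.choose)) else none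
  unique s v := by
    refine ⟨tableTest (at_ s) fun k => decide ((at_ s k).Holds v), ⟨?_, ?_⟩, ?_⟩
    · rw [tableTest_holds]
      intro k
      simp
    · rw [dif_pos ⟨_, rfl⟩]
      rfl
    · rintro τ ⟨hv, hs⟩
      by_cases h : ∃ b, τ = tableTest (at_ s) b
      · obtain ⟨b, rfl⟩ := h
        rw [tableTest_holds] at hv
        congr 1
        funext k
        by_cases hk : (at_ s k).Holds v
        · simp [hk, (hv k).2 hk]
        · have hb : ¬ (b k = true) := fun hb => hk ((hv k).1 hb)
          simp [hk, hb]
      · simp [h] at hs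

/-! ### Terms used by the monitors -/

namespace Term

variable {R : Type}

/-- The numeral `k`. -/
def ofNat : ℕ → Term R
  | 0 => zero
  | k + 1 => add (ofNat k) one

/-- `t + z` for an integer constant `z`. -/
def addInt (t : Term R) (z : ℤ) : Term R := sub (add t (ofNat z.toNat)) (ofNat (-z).toNat)

/-- The product of a list of terms. -/
def prod : List (Term R) → Term R
  | [] => one
  | t :: l => mul t (prod l)

/-- The number `t! / (t - k)! = t (t - 1) ⋯ (t - k + 1)` of permutations of `k` items
out of `t`. -/
def perm (t : Term R) (k : ℕ) : Term R := prod ((List.range k).map fun i => sub t (ofNat i))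

/-- Replaces the registers of a term. -/
def rename {R' : Type} (f : R → R') : Term R → Term R'
  | zero => zero
  | one => one
  | reg r => reg (f r)
  | add s t => add (s.rename f) (t.rename f)
  | sub s t => sub (s.rename f) (t.rename f)
  | mul s t => mul (s.rename f) (t.rename f)
  | div s t => div (s.rename f) (t.rename f)

end Term

def Atom.rename {R R' : Type} (f : R → R') : Atom R → Atom R'
  | .le s t => .le (s.rename f) (t.rename f)
  | .eq s t => .eq (s.rename f) (t.rename f)

/-! ### `BayesExpMonitor`

The parameters are the exponent matrices `d^l`, `l = 1, …, p`, of a polynomial form, and `θ`. -/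

/-- The registers of `BayesExpMonitor`. `prev` holds `0` before the first symbol, and then the
number `σ + 1` of the previous state `σ : Fin (n + 1)`; `cnt i j` and `row i` are the counters
`c̄_{ij}` and `c̄_i`; `active` is `0` or `1`; and `h^l` is kept as the fraction `num l / den l`. -/
inductive ExpReg (n p : ℕ) : Type
  | prev : ExpReg n p
  | cnt (i j : Fin (n + 1)) : ExpReg n p
  | row (i : Fin (n + 1)) : ExpReg n p
  | active : ExpReg n p
  | num (l : Fin p) : ExpReg n p
  | den (l : Fin p) : ExpReg n p
  deriving Fintype

/-- The names of the conditions that `BayesExpMonitor` evaluates: the previous state is `q`;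
`active = 1`; the consistency condition for `v_{ij}` after the increment of the counters,
when the previous state is `q`. -/
inductive ExpCond (n : ℕ) : Type
  | prevIs (q : Fin (n + 1)) : ExpCond n
  | isActive : ExpCond n
  | consistent (q i j : Fin (n + 1)) : ExpCond n
  deriving Fintype

namespace ExpMonitor

variable {n p : ℕ}

/-- `d_i = ∑_j d_{ij}` -/
def rowExp (d : Fin (n + 1) → Fin (n + 1) → ℤ) (i : Fin (n + 1)) : ℤ := ∑ j, d i j

/-- `m_{ij} = min_l d_{ij}^l` -/
noncomputable def minExp (d : Fin p → Fin (n + 1) → Fin (n + 1) → ℤ) (i j : Fin (n + 1)) : ℤ :=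
  ⨅ l, d l i j

/-- The counter `c̄_{ij}` after the increment for the step from `q` to `s`. -/
def cntNext (q s i j : Fin (n + 1)) : Term (ExpReg n p) :=
  if i = q ∧ j = s then .add (.reg (.cnt i j)) .one else .reg (.cnt i j)

/-- The counter `c̄_i` after the increment for a step from `q`. -/
def rowNext (q i : Fin (n + 1)) : Term (ExpReg n p) :=
  if i = q then .add (.reg (.row i)) .one else .reg (.row i)

/-- The numerator of `H`, for counters given by the terms `c` and `r`:
`∏_i ∏_{d_{ij} > 0} P(c̄_{ij} - 1 + |d_{ij}|, |d_{ij}|) · ∏_{d_i < 0} P(c̄_i - 1, |d_i|)`. -/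
def numH {R : Type} (d : Fin (n + 1) → Fin (n + 1) → ℤ)
    (c : Fin (n + 1) → Fin (n + 1) → Term R) (r : Fin (n + 1) → Term R) : Term R :=
  .mul
    (.prod ((List.finRange (n + 1)).map fun i =>
      .prod (((List.finRange (n + 1)).filter fun j => 0 < d i j).map fun j =>
        .perm (.add (.sub (c i j) .one) (.ofNat (d i j).natAbs)) (d i j).natAbs)))
    (.prod (((List.finRange (n + 1)).filter fun i => rowExp d i < 0).map fun i =>
      .perm (.sub (r i) .one) (rowExp d i).natAbs))

/-- The denominator of `H`:
`∏_{d_i > 0} P(c̄_i - 1 + |d_i|, |d_i|) · ∏_i ∏_{d_{ij} < 0} P(c̄_{ij} - 1, |d_{ij}|)`. -/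
def denH {R : Type} (d : Fin (n + 1) → Fin (n + 1) → ℤ)
    (c : Fin (n + 1) → Fin (n + 1) → Term R) (r : Fin (n + 1) → Term R) : Term R :=
  .mul
    (.prod (((List.finRange (n + 1)).filter fun i => 0 < rowExp d i).map fun i =>
      .perm (.add (.sub (r i) .one) (.ofNat (rowExp d i).natAbs)) (rowExp d i).natAbs))
    (.prod ((List.finRange (n + 1)).map fun i =>
      .prod (((List.finRange (n + 1)).filter fun j => d i j < 0).map fun j =>
        .perm (.sub (c i j) .one) (d i j).natAbs)))

/-- `Init(s)` -/
def initUpdate (θ : Fin (n + 1) → Fin (n + 1) → ℕ) (s : Fin (n + 1)) : Update (ExpReg n p)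
  | .prev => .ofNat (s.val + 1)
  | .cnt i j => .ofNat (θ i j)
  | .row i => .ofNat (∑ j, θ i j)
  | .active => .zero
  | .num _ => .zero
  | .den _ => .zero

/-- `Next(s)` when the previous state is `q`. The truth value of `active` before the call is
`act`, and that of the consistency condition after the increment of the counters is `ok`. -/
def nextUpdate (d : Fin p → Fin (n + 1) → Fin (n + 1) → ℤ) (q s : Fin (n + 1)) (act ok : Bool) :
    Update (ExpReg n p)
  | .prev => .ofNat (s.val + 1)
  | .cnt i j => cntNext q s i j
  | .row i => rowNext q i
  | .active => if act || ok then .one else .zero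
  | .num l =>
      if act then
        .mul (.reg (.num l))
          (.mul (.addInt (.sub (cntNext q s q s) .one) (d l q s)) (.sub (rowNext q q) .one))
      else if ok then numH (d l) (cntNext q s) (rowNext q)
      else .reg (.num l)
  | .den l =>
      if act then
        .mul (.reg (.den l))
          (.mul (.sub (cntNext q s q s) .one)
            (.addInt (.sub (rowNext q q) .one) (rowExp (d l) q)))
      else if ok then denH (d l) (cntNext q s) (rowNext q)
      else .reg (.den l)

/-- The conditions as atomic formulas, on the input symbol `s`; the consistency condition
`c̄_{ij} + m_{ij} > 0` is `1 ≤ c̄_{ij} + m_{ij}`. -/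
noncomputable def atoms (d : Fin p → Fin (n + 1) → Fin (n + 1) → ℤ) (s : Fin (n + 1)) :
    ExpCond n → Atom (ExpReg n p)
  | .prevIs q => .eq (.reg .prev) (.ofNat (q.val + 1))
  | .isActive => .eq (.reg .active) .one
  | .consistent q i j => .le .one (.addInt (cntNext q s i j) (minExp d i j))

open Classical in
/-- One call: `Init` on the first symbol, and `Next` afterwards. The consistency condition
ranges over the variables that occur in the polynomial form. -/
noncomputable def update (θ : Fin (n + 1) → Fin (n + 1) → ℕ)
    (d : Fin p → Fin (n + 1) → Fin (n + 1) → ℤ) (s : Fin (n + 1)) (b : ExpCond n → Bool) :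
    Update (ExpReg n p) :=
  if h : ∃ q, b (.prevIs q) = true then
    nextUpdate d h.choose s (b .isActive)
      (decide (∀ i j, (∃ l, d l i j ≠ 0) → b (.consistent h.choose i j) = true))
  else initUpdate θ s

/-- The value `E` of the monitor for the polynomial form `P`: `⊥` unless it is active, and then
`∑_l κ_l h^l`. -/
noncomputable def value (P : PolyForm (Fin (n + 1))) (v : ExpReg n P.length → ℕ) : Option ℝ :=
  if v .active = 1 then
    some (∑ l : Fin P.length, (P.get l).1 * ((v (.num l) : ℝ) / (v (.den l) : ℝ)))
  else none

end ExpMonitor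

/-! ### `BayesConfIntMonitor` -/

/-- The verdict `[E ± √((E₂ - E²) / δ)]`, or `⊥` if `E` or `E₂` is `⊥`. -/
noncomputable def confInt (δ : ℝ) : Option ℝ → Option ℝ → Verdict
  | some E, some E₂ => some (E - √((E₂ - E ^ 2) / δ), E + √((E₂ - E ^ 2) / δ))
  | _, _ => none

/-- `BayesConfIntMonitor`: it runs in parallel `BayesExpMonitor` for the polynomial forms of `φ`
(on the left registers) and of `φ² = φ · φ` (on the right registers). -/
noncomputable def bayesConfIntMonitor {n : ℕ} (φ : PSE (Fin (n + 1)))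
    (θ : Fin (n + 1) → Fin (n + 1) → ℕ) (δ : ℝ) : RegisterMonitor (Fin (n + 1)) Verdict :=
  let P : PolyForm (Fin (n + 1)) := φ.polyForm
  let P₂ : PolyForm (Fin (n + 1)) := (φ.mul φ).polyForm
  let d : Fin P.length → Fin (n + 1) → Fin (n + 1) → ℤ := fun l => (P.get l).2
  let d₂ : Fin P₂.length → Fin (n + 1) → Fin (n + 1) → ℤ := fun l => (P₂.get l).2
  tableMonitor (R := ExpReg n P.length ⊕ ExpReg n P₂.length) (ι := ExpCond n ⊕ ExpCond n)
    (fun v => confInt δ (ExpMonitor.value P (v ∘ Sum.inl)) (ExpMonitor.value P₂ (v ∘ Sum.inr)))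
    (fun s => Sum.elim (fun k => (ExpMonitor.atoms d s k).rename Sum.inl)
      (fun k => (ExpMonitor.atoms d₂ s k).rename Sum.inr))
    (fun s b => Sum.elim (fun r => (ExpMonitor.update θ d s (b ∘ Sum.inl) r).rename Sum.inl)
      (fun r => (ExpMonitor.update θ d₂ s (b ∘ Sum.inr) r).rename Sum.inr))

/-! ### The consistency condition -/

/-- The number `c_{ij}(x)` of occurrences of `ij` in the word `x`. -/
def edgeCount {Q : Type} [DecidableEq Q] (i j : Q) : List Q → ℕ
  | a :: b :: w => (if a = i ∧ b = j then 1 else 0) + edgeCount i j (b :: w)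
  | _ => 0

/-- `c_{ij}(x) + θ_{ij} + d_{ij}^l > 0` for every `i`, `j` and every summand `l`. -/
def Consistent {Q : Type} [DecidableEq Q] (θ : Q → Q → ℕ) (P : PolyForm Q) (x : List Q) : Prop :=
  ∀ t ∈ P, ∀ i j, 0 < (edgeCount i j x : ℤ) + θ i j + t.2 i j

/-- At least one transition has been observed, and the consistency condition holds for the
polynomial forms of `φ` and `φ²`. -/
def Ready {Q : Type} [DecidableEq Q] (θ : Q → Q → ℕ) (φ : PSE Q) (x : List Q) : Prop :=
  2 ≤ x.length ∧ Consistent θ φ.polyForm x ∧ Consistent θ (φ.mul φ).polyForm x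

end BayesMonitor

/-!
The family of matrix beta distributions is closed under multiplication by monomials: if all
`c_{ij}` and `c_{ij} + d_{ij}` are positive, then `∏ M_{ij} ^ d_{ij}` times the density `p_c` is
`m(c, d) p_{c + d}`, where `m(c, d) = ∏_i B(c_i + d_i) / B(c_i)` and `B` is the multivariate beta
function of a row. With the transition counts of a word as exponents this is the conjugacy of the
prior: the posterior is matrix beta with parameter `c̄ = θ + c(x)`. With the exponents of a monomial
of `φ` it says that the posterior mean of that monomial is `m(c̄, d)`.

Since `Γ(c + z) / Γ(c)` is a permutation number or the inverse of one, the formula with which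
the monitor initializes `h^l` is `m(c̄, d^l)`; since `Γ(x + 1) = x Γ(x)`, incrementing one counter
multiplies `m(c̄, d^l)` by exactly the factor by which the monitor updates `h^l`. So `h^l` is always
the posterior mean of the `l`-th monomial, hence `E` is the posterior mean of `φ` and `E₂ - E²`
its posterior variance, and Chebyshev's inequality bounds the probability of missing the interval.
-/

namespace BayesMonitor

/-! ### The Dirichlet integral -/

section Dirichlet

open Set

/-- The multivariate beta function `B(a) = ∏_i Γ(a_i) / Γ(∑_i a_i)`, the normalizing constant of
the Dirichlet distribution. -/
noncomputable def multivariateBeta {ι : Type*} [Fintype ι] (a : ι → ℝ) : ℝ :=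
  (∏ i, Real.Gamma (a i)) / Real.Gamma (∑ i, a i)

theorem multivariateBeta_pos {ι : Type*} [Fintype ι] [Nonempty ι] {a : ι → ℝ}
    (ha : ∀ i, 0 < a i) : 0 < multivariateBeta a :=
  div_pos (Finset.prod_pos fun i _ => Real.Gamma_pos_of_pos (ha i))
    (Real.Gamma_pos_of_pos (Finset.sum_pos (fun i _ => ha i) Finset.univ_nonempty))

theorem setLIntegral_Ioo_rpow_mul_one_sub_rpow {a b : ℝ} (ha : 0 < a) (hb : 0 < b) :
    ∫⁻ x in Ioo 0 1, ENNReal.ofReal (x ^ (a - 1) * (1 - x) ^ (b - 1)) =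
      ENNReal.ofReal (beta a b) := by
  have hB := beta_pos ha hb
  have h := lintegral_betaPDF_eq_one ha hb
  simp only [lintegral_betaPDF, mul_assoc, ENNReal.ofReal_mul (one_div_pos.2 hB).le] at h
  rw [lintegral_const_mul' _ _ ENNReal.ofReal_ne_top, one_div, ENNReal.ofReal_inv_of_pos hB] at h
  exact (ENNReal.eq_inv_of_mul_eq_one_left ((mul_comm _ _).trans h)).trans (inv_inv _)

theorem setLIntegral_Ioo_rpow_mul_sub_rpow {a b s : ℝ} (ha : 0 < a) (hb : 0 < b) (hs : 0 < s) :
    ∫⁻ t in Ioo 0 s, ENNReal.ofReal (t ^ (a - 1) * (s - t) ^ (b - 1)) =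
      ENNReal.ofReal (s ^ (a + b - 1) * beta a b) := by
  have himage : (s * ·) '' Ioo 0 1 = Ioo 0 s := by
    rw [image_mul_left_Ioo hs, mul_zero, mul_one]
  have hderiv : ∀ x ∈ Ioo (0 : ℝ) 1, HasDerivWithinAt (s * ·) s (Ioo 0 1) x := fun x _ => by
    simpa using ((hasDerivAt_id x).const_mul s).hasDerivWithinAt
  rw [← himage, lintegral_image_eq_lintegral_abs_deriv_mul measurableSet_Ioo hderiv
    (mul_right_injective₀ hs.ne').injOn, abs_of_pos hs, ENNReal.ofReal_mul (by positivity),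
    ← setLIntegral_Ioo_rpow_mul_one_sub_rpow ha hb,
    ← lintegral_const_mul' _ _ ENNReal.ofReal_ne_top]
  refine setLIntegral_congr_fun measurableSet_Ioo fun x hx => ?_
  have hpow : s ^ (a + b - 1) = s * (s ^ (a - 1) * s ^ (b - 1)) := by
    nth_rewrite 2 [← Real.rpow_one s]
    rw [← Real.rpow_add hs, ← Real.rpow_add hs]
    ring_nf
  rw [← ENNReal.ofReal_mul hs.le, ← ENNReal.ofReal_mul (by positivity), ← mul_one_sub,
    Real.mul_rpow hs.le hx.1.le, Real.mul_rpow hs.le (sub_pos.2 hx.2).le, hpow]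
  ring_nf

/-- The solid simplex of size `s`, the domain of the Dirichlet integral. All sizes are needed since
slicing off one coordinate changes the size. -/
def solidSimplex (n : ℕ) (s : ℝ) : Set (Fin n → ℝ) := {y | (∀ i, 0 ≤ y i) ∧ ∑ i, y i ≤ s}

theorem measurableSet_solidSimplex (n : ℕ) (s : ℝ) : MeasurableSet (solidSimplex n s) := by
  unfold solidSimplex
  measurability

theorem cons_mem_solidSimplex_iff {n : ℕ} {s t : ℝ} {z : Fin n → ℝ} :
    (Fin.cons t z : Fin (n + 1) → ℝ) ∈ solidSimplex (n + 1) s ↔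
      t ∈ Icc 0 s ∧ z ∈ solidSimplex n (s - t) := by
  simp only [solidSimplex, mem_ofPred_eq, Fin.sum_univ_succ, Fin.cons_zero, Fin.cons_succ,
    Fin.forall_fin_succ, mem_Icc]
  constructor
  · rintro ⟨⟨ht, hz⟩, hsum⟩
    have := Finset.sum_nonneg fun i (_ : i ∈ Finset.univ) => hz i
    exact ⟨⟨ht, by linarith⟩, hz, by linarith⟩
  · rintro ⟨⟨ht, -⟩, hz, hsum⟩
    exact ⟨⟨ht, hz⟩, by linarith⟩

theorem setLIntegral_solidSimplex_succ {n : ℕ} {s : ℝ} {f : (Fin (n + 1) → ℝ) → ℝ≥0∞}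
    (hf : Measurable f) :
    ∫⁻ y in solidSimplex (n + 1) s, f y =
      ∫⁻ t in Icc 0 s, ∫⁻ z in solidSimplex n (s - t), f (Fin.cons t z) := by
  let e := MeasurableEquiv.piFinSuccAbove (fun _ : Fin (n + 1) => ℝ) 0
  have he : ∀ t z, e.symm (t, z) = Fin.cons t z := fun t z => by
    simp [e, MeasurableEquiv.piFinSuccAbove, Fin.consEquiv]
  have hind := hf.indicator (measurableSet_solidSimplex (n + 1) s)
  have hind' : Measurable fun p => (solidSimplex (n + 1) s).indicator f (e.symm p) :=
    hind.comp e.symm.measurable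
  rw [← lintegral_indicator (measurableSet_solidSimplex _ _),
    ← ((volume_preserving_piFinSuccAbove (fun _ => ℝ) 0).symm e).lintegral_comp hind,
    Measure.volume_eq_prod, lintegral_prod _ hind'.aemeasurable,
    ← lintegral_indicator measurableSet_Icc]
  refine lintegral_congr fun t => ?_
  by_cases ht : t ∈ Icc 0 s
  · rw [indicator_of_mem ht, ← lintegral_indicator (measurableSet_solidSimplex _ _)]
    refine lintegral_congr fun z => ?_
    classical
    rw [he, indicator_apply, indicator_apply]
    exact if_congr (cons_mem_solidSimplex_iff.trans (and_iff_right ht)) rfl rfl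
  · simp only [he, indicator, cons_mem_solidSimplex_iff, ht, false_and, if_false, lintegral_zero]

theorem beta_mul_multivariateBeta_tail {n : ℕ} {a : Fin (n + 1) → ℝ} {b : ℝ}
    (h : 0 < b + ∑ i : Fin n, a i.succ) :
    beta (a 0) (b + ∑ i : Fin n, a i.succ) *
        multivariateBeta (Fin.cons b fun i => a i.succ : Fin (n + 1) → ℝ) =
      multivariateBeta (Fin.cons b a : Fin (n + 2) → ℝ) := by
  have hΓ := (Real.Gamma_pos_of_pos h).ne'
  simp only [beta, multivariateBeta, Fin.sum_univ_succ, Fin.prod_univ_succ, Fin.cons_zero,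
    Fin.cons_succ, add_left_comm (a 0) b]
  field_simp

theorem setLIntegral_solidSimplex {n : ℕ} {a : Fin n → ℝ} {b s : ℝ} (ha : ∀ i, 0 < a i)
    (hb : 0 < b) (hs : 0 < s) :
    ∫⁻ y in solidSimplex n s, ENNReal.ofReal ((s - ∑ i, y i) ^ (b - 1) * ∏ i, y i ^ (a i - 1)) =
      ENNReal.ofReal
        (s ^ (b + ∑ i, a i - 1) * multivariateBeta (Fin.cons b a : Fin (n + 1) → ℝ)) := by
  induction n generalizing s with
  | zero =>
    rw [← lintegral_indicator (measurableSet_solidSimplex _ _), lintegral_unique]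
    simp [solidSimplex, hs.le, multivariateBeta, volume_pi, (Real.Gamma_pos_of_pos hb).ne']
  | succ n ih =>
    have hbA : 0 < b + ∑ i : Fin n, a i.succ :=
      add_pos_of_pos_of_nonneg hb (Finset.sum_nonneg fun i _ => (ha i.succ).le)
    have hB : 0 < multivariateBeta (Fin.cons b fun i => a i.succ : Fin (n + 1) → ℝ) :=
      multivariateBeta_pos (Fin.cases hb fun i => ha i.succ)
    have hinner : ∀ t ∈ Ioo 0 s,
        ∫⁻ z in solidSimplex n (s - t), ENNReal.ofReal
          ((s - ∑ i, (Fin.cons t z : Fin (n + 1) → ℝ) i) ^ (b - 1) *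
            ∏ i, (Fin.cons t z : Fin (n + 1) → ℝ) i ^ (a i - 1)) =
        ENNReal.ofReal (t ^ (a 0 - 1) * (s - t) ^ (b + ∑ i : Fin n, a i.succ - 1)) *
          ENNReal.ofReal (multivariateBeta (Fin.cons b fun i => a i.succ)) := fun t ht => by
      have hpow := Real.rpow_nonneg ht.1.le (a 0 - 1)
      rw [← ENNReal.ofReal_mul' hB.le, mul_assoc, ENNReal.ofReal_mul hpow,
        ← ih (fun i => ha i.succ) (sub_pos.2 ht.2),
        ← lintegral_const_mul' _ _ ENNReal.ofReal_ne_top]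
      refine lintegral_congr fun z => ?_
      rw [← ENNReal.ofReal_mul hpow, Fin.sum_cons, Fin.prod_univ_succ]
      simp only [Fin.cons_zero, Fin.cons_succ, sub_add_eq_sub_sub, mul_left_comm]
    rw [setLIntegral_solidSimplex_succ (by fun_prop), ← setLIntegral_congr Ioo_ae_eq_Icc,
      setLIntegral_congr_fun measurableSet_Ioo hinner,
      lintegral_mul_const' _ _ ENNReal.ofReal_ne_top,
      setLIntegral_Ioo_rpow_mul_sub_rpow (ha 0) hbA hs, ← ENNReal.ofReal_mul' hB.le, mul_assoc,
      beta_mul_multivariateBeta_tail hbA, add_left_comm (a 0) b, ← Fin.sum_univ_succ]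

end Dirichlet

/-! ### Dirichlet and matrix beta distributions -/

section MatrixBeta

theorem measurable_simplexParam {n : ℕ} :
    Measurable fun y : Fin n → ℝ => (Fin.cons (1 - ∑ i, y i) y : Fin (n + 1) → ℝ) :=
  measurable_pi_lambda _ (Fin.cases (by simp only [Fin.cons_zero]; fun_prop)
    fun j => by simp only [Fin.cons_succ]; fun_prop)

theorem simplexVolume_eq_map (n : ℕ) :
    simplexVolume n = (volume.restrict (solidSimplex n 1)).map
      fun y => (Fin.cons (1 - ∑ i, y i) y : Fin (n + 1) → ℝ) := rfl

theorem lintegral_simplexVolume {n : ℕ} {a : Fin (n + 1) → ℝ} (ha : ∀ j, 0 < a j) :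
    ∫⁻ y, ENNReal.ofReal (∏ j, y j ^ (a j - 1)) ∂simplexVolume n =
      ENNReal.ofReal (multivariateBeta a) := by
  rw [simplexVolume_eq_map, lintegral_map (by fun_prop) measurable_simplexParam]
  have h := setLIntegral_solidSimplex (fun i => ha (Fin.succ i)) (ha 0) one_pos
  rw [Real.one_rpow, one_mul] at h
  simp only [Fin.prod_univ_succ, Fin.cons_zero, Fin.cons_succ]
  exact h.trans (congrArg (ENNReal.ofReal <| multivariateBeta ·) (Fin.cons_self_tail a))

theorem ae_sum_ne {ι : Type*} [Fintype ι] {s : ℝ} (hs : s ≠ 0) :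
    ∀ᵐ y : ι → ℝ, ∑ i, y i ≠ s := by
  cases isEmpty_or_nonempty ι with
  | inl _ => simp [hs.symm]
  | inr hι =>
    classical
    obtain ⟨j⟩ := hι
    let L : (ι → ℝ) →ₗ[ℝ] ℝ := ∑ i, LinearMap.proj i
    have hL : Function.Surjective L := fun t => ⟨Pi.single j t, by simp [L]⟩
    simpa [L] using (ae_comp_linearMap_mem_iff L volume volume hL
      (measurableSet_singleton s).compl).2 (Measure.ae_ne volume s)

theorem ae_pos_simplexVolume (n : ℕ) : ∀ᵐ y ∂simplexVolume n, ∀ j, 0 < y j := by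
  rw [simplexVolume_eq_map, ae_map_iff measurable_simplexParam.aemeasurable (by measurability),
    ae_restrict_iff' (measurableSet_solidSimplex n 1)]
  have hne : ∀ᵐ y : Fin n → ℝ, ∀ i, y i ≠ 0 :=
    ae_all_iff.2 fun i => Measure.ae_eval_ne (fun _ => volume) i 0
  filter_upwards [ae_sum_ne one_ne_zero, hne] with y hsum hy hmem
  exact Fin.cases (sub_pos.2 (hmem.2.lt_of_ne hsum)) fun j => (hmem.1 j).lt_of_ne (hy j).symm

instance isFiniteMeasure_simplexVolume (n : ℕ) : IsFiniteMeasure (simplexVolume n) := by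
  have h := lintegral_simplexVolume (n := n) (a := 1) fun _ => one_pos
  simp only [Pi.one_apply, sub_self, Real.rpow_zero, Finset.prod_const_one, ENNReal.ofReal_one,
    lintegral_one] at h
  exact ⟨h ▸ ENNReal.ofReal_lt_top⟩

theorem ae_pos_stochVolume (n : ℕ) : ∀ᵐ M ∂stochVolume n, ∀ i j, 0 < M i j :=
  ae_all_iff.2 fun i => (Measure.quasiMeasurePreserving_eval (μ := fun _ => simplexVolume n) i).ae
    (ae_pos_simplexVolume n)

/-- The density `B(a)⁻¹ ∏_j y_j ^ (a_j - 1)` of the Dirichlet distribution with parameter `a`, a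
family of positive integers. It is the density of a row under the matrix beta distribution. -/
noncomputable def dirichletDensity {ι : Type*} [Fintype ι] (a : ι → ℕ) (y : ι → ℝ) : ℝ :=
  (multivariateBeta fun j => (a j : ℝ))⁻¹ * ∏ j, y j ^ (a j - 1)

theorem dirichletDensity_nonneg {ι : Type*} [Fintype ι] (a : ι → ℕ) {y : ι → ℝ}
    (hy : ∀ j, 0 ≤ y j) : 0 ≤ dirichletDensity a y :=
  mul_nonneg (inv_nonneg.2 (div_nonneg
    (Finset.prod_nonneg fun _ _ => Real.Gamma_nonneg_of_nonneg (Nat.cast_nonneg _))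
    (Real.Gamma_nonneg_of_nonneg (Finset.sum_nonneg fun _ _ => Nat.cast_nonneg _))))
    (Finset.prod_nonneg fun j _ => pow_nonneg (hy j) _)

theorem lintegral_dirichletDensity {n : ℕ} {a : Fin (n + 1) → ℕ} (ha : ∀ j, 0 < a j) :
    ∫⁻ y, ENNReal.ofReal (dirichletDensity a y) ∂simplexVolume n = 1 := by
  have ha' : ∀ j, (0 : ℝ) < a j := fun j => Nat.cast_pos.2 (ha j)
  have hB := multivariateBeta_pos ha'
  have hpow : ∀ (y : Fin (n + 1) → ℝ) j, y j ^ (a j - 1) = y j ^ ((a j : ℝ) - 1) := fun y j => by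
    rw [← Nat.cast_pred (ha j), Real.rpow_natCast]
  simp only [dirichletDensity, hpow, ENNReal.ofReal_mul (inv_pos.2 hB).le]
  rw [lintegral_const_mul' _ _ ENNReal.ofReal_ne_top, lintegral_simplexVolume ha',
    ← ENNReal.ofReal_mul (inv_pos.2 hB).le, inv_mul_cancel₀ hB.ne', ENNReal.ofReal_one]

theorem measurable_dirichletDensity {ι : Type*} [Fintype ι] (a : ι → ℕ) :
    Measurable (dirichletDensity a) := by
  unfold dirichletDensity
  fun_prop

theorem ae_nonneg_dirichletDensity {n : ℕ} (a : Fin (n + 1) → ℕ) :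
    0 ≤ᵐ[simplexVolume n] dirichletDensity a :=
  (ae_pos_simplexVolume n).mono fun _ hy => dirichletDensity_nonneg a fun j => (hy j).le

theorem integrable_dirichletDensity {n : ℕ} {a : Fin (n + 1) → ℕ} (ha : ∀ j, 0 < a j) :
    Integrable (dirichletDensity a) (simplexVolume n) := by
  refine ⟨(measurable_dirichletDensity a).aestronglyMeasurable, ?_⟩
  rw [hasFiniteIntegral_iff_ofReal (ae_nonneg_dirichletDensity a), lintegral_dirichletDensity ha]
  exact ENNReal.one_lt_top

theorem integral_dirichletDensity {n : ℕ} {a : Fin (n + 1) → ℕ} (ha : ∀ j, 0 < a j) :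
    ∫ y, dirichletDensity a y ∂simplexVolume n = 1 := by
  rw [integral_eq_lintegral_of_nonneg_ae (ae_nonneg_dirichletDensity a)
    (measurable_dirichletDensity a).aestronglyMeasurable, lintegral_dirichletDensity ha,
    ENNReal.toReal_one]

variable {n : ℕ} {c : Fin (n + 1) → Fin (n + 1) → ℕ}

theorem matrixBetaDensity_eq_prod (c : Fin (n + 1) → Fin (n + 1) → ℕ)
    (M : Fin (n + 1) → Fin (n + 1) → ℝ) :
    matrixBetaDensity c M = ∏ i, dirichletDensity (c i) (M i) := by
  simp only [matrixBetaDensity, dirichletDensity, multivariateBeta, inv_div,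
    Finset.prod_mul_distrib]

theorem measurable_matrixBetaDensity (c : Fin (n + 1) → Fin (n + 1) → ℕ) :
    Measurable (matrixBetaDensity c) := by
  unfold matrixBetaDensity
  fun_prop

theorem matrixBetaDensity_nonneg (c : Fin (n + 1) → Fin (n + 1) → ℕ)
    {M : Fin (n + 1) → Fin (n + 1) → ℝ} (hM : ∀ i j, 0 ≤ M i j) : 0 ≤ matrixBetaDensity c M := by
  rw [matrixBetaDensity_eq_prod]
  exact Finset.prod_nonneg fun i _ => dirichletDensity_nonneg (c i) (hM i)

theorem ae_pos_matrixBeta (c : Fin (n + 1) → Fin (n + 1) → ℕ) :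
    ∀ᵐ M ∂matrixBeta c, ∀ i j, 0 < M i j :=
  (withDensity_absolutelyContinuous _ _).ae_le (ae_pos_stochVolume n)

theorem isProbabilityMeasure_matrixBeta (hc : ∀ i j, 0 < c i j) :
    IsProbabilityMeasure (matrixBeta c) := by
  constructor
  have hint : Integrable (matrixBetaDensity c) (stochVolume n) := by
    rw [funext (matrixBetaDensity_eq_prod c)]
    exact Integrable.fintype_prod fun i => integrable_dirichletDensity (hc i)
  have hnonneg : 0 ≤ᵐ[stochVolume n] matrixBetaDensity c :=
    (ae_pos_stochVolume n).mono fun M hM => matrixBetaDensity_nonneg c fun i j => (hM i j).le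
  rw [matrixBeta, withDensity_apply _ .univ, Measure.restrict_univ,
    ← ofReal_integral_eq_lintegral_ofReal hint hnonneg, stochVolume]
  simp only [matrixBetaDensity_eq_prod]
  rw [integral_fintype_prod_eq_prod fun i => dirichletDensity (c i),
    Finset.prod_congr rfl fun i _ => integral_dirichletDensity (hc i), Finset.prod_const_one,
    ENNReal.ofReal_one]

end MatrixBeta

/-! ### Moments and conjugacy -/

section Moments

/-- The value at `M` of the monomial `∏_{i,j} v_{ij} ^ d_{ij}`. -/
noncomputable def monomialVal {Q : Type*} [Fintype Q] (d : Q → Q → ℤ) (M : Q → Q → ℝ) : ℝ :=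
  ∏ i, ∏ j, M i j ^ d i j

theorem measurable_monomialVal {Q : Type*} [Fintype Q] (d : Q → Q → ℤ) :
    Measurable (monomialVal d) := by
  unfold monomialVal
  fun_prop

theorem monomialVal_nonneg {Q : Type*} [Fintype Q] (d : Q → Q → ℤ) {M : Q → Q → ℝ}
    (hM : ∀ i j, 0 ≤ M i j) : 0 ≤ monomialVal d M :=
  Finset.prod_nonneg fun i _ => Finset.prod_nonneg fun j _ => zpow_nonneg (hM i j) _

theorem monomialVal_add {Q : Type*} [Fintype Q] (d e : Q → Q → ℤ) {M : Q → Q → ℝ}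
    (hM : ∀ i j, M i j ≠ 0) :
    monomialVal (fun i j => d i j + e i j) M = monomialVal d M * monomialVal e M := by
  simp only [monomialVal, zpow_add₀ (hM _ _), Finset.prod_mul_distrib]

theorem monomialVal_neg {Q : Type*} [Fintype Q] (d : Q → Q → ℤ) (M : Q → Q → ℝ) :
    monomialVal (fun i j => -d i j) M = (monomialVal d M)⁻¹ := by
  simp only [monomialVal, zpow_neg, Finset.prod_inv_distrib]

theorem monomialVal_indicator {Q : Type*} [Fintype Q] [DecidableEq Q] (a b : Q) (M : Q → Q → ℝ) :
    monomialVal (fun i j => if i = a ∧ j = b then 1 else 0) M = M a b := by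
  rw [monomialVal, Finset.prod_eq_single a _ (by simp), Finset.prod_eq_single b _ (by simp)]
  · simp
  · intro j _ hj
    simp [hj]
  · intro i _ hi
    simp [hi]

/-- The moment `𝔼(∏_j y_j ^ d_j)` of the Dirichlet distribution with parameter `a`, in terms of the
multivariate beta function. It is meaningful when every `a_j + d_j` is positive. -/
noncomputable def dirichletMoment {ι : Type*} [Fintype ι] (a : ι → ℕ) (d : ι → ℤ) : ℝ :=
  multivariateBeta (fun j => (a j : ℝ) + d j) / multivariateBeta fun j => (a j : ℝ)

/-- The moment `𝔼(∏_{i,j} M_{ij} ^ d_{ij})` of the matrix beta distribution with parameter `c`,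
whose rows are independent. -/
noncomputable def matrixBetaMoment {Q : Type*} [Fintype Q] (c : Q → Q → ℕ) (d : Q → Q → ℤ) : ℝ :=
  ∏ i, dirichletMoment (c i) (d i)

theorem dirichletMoment_pos {ι : Type*} [Fintype ι] [Nonempty ι] {a : ι → ℕ} {d : ι → ℤ}
    (ha : ∀ j, 0 < a j) (hd : ∀ j, 0 < (a j : ℤ) + d j) : 0 < dirichletMoment a d :=
  div_pos (multivariateBeta_pos fun j => by exact_mod_cast hd j)
    (multivariateBeta_pos fun j => by exact_mod_cast ha j)

theorem matrixBetaMoment_pos {Q : Type*} [Fintype Q] {c : Q → Q → ℕ} {d : Q → Q → ℤ}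
    (hc : ∀ i j, 0 < c i j) (hd : ∀ i j, 0 < (c i j : ℤ) + d i j) : 0 < matrixBetaMoment c d :=
  Finset.prod_pos fun i _ => haveI : Nonempty Q := ⟨i⟩; dirichletMoment_pos (hc i) (hd i)

theorem dirichletDensity_mul_prod_zpow {ι : Type*} [Fintype ι] [Nonempty ι] {a a' : ι → ℕ}
    {d : ι → ℤ} (ha : ∀ j, 0 < a j) (ha' : ∀ j, 0 < a' j) (h : ∀ j, (a' j : ℤ) = a j + d j)
    {y : ι → ℝ} (hy : ∀ j, y j ≠ 0) :
    dirichletDensity a y * ∏ j, y j ^ d j = dirichletMoment a d * dirichletDensity a' y := by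
  have hB : 0 < multivariateBeta fun j => (a' j : ℝ) :=
    multivariateBeta_pos fun j => Nat.cast_pos.2 (ha' j)
  have hpow : ∀ j, y j ^ (a j - 1) * y j ^ d j = y j ^ (a' j - 1) := fun j => by
    rw [← zpow_natCast, ← zpow_natCast, ← zpow_add₀ (hy j)]
    congr 1
    have := ha j
    have := ha' j
    have := h j
    lia
  have hcast : ∀ j, (a j : ℝ) + d j = a' j := fun j => by exact_mod_cast (h j).symm
  simp only [dirichletDensity, dirichletMoment, mul_assoc, ← Finset.prod_mul_distrib, hpow, hcast]
  field_simp

variable {n : ℕ} {c : Fin (n + 1) → Fin (n + 1) → ℕ} {d : Fin (n + 1) → Fin (n + 1) → ℤ}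

theorem withDensity_matrixBeta_monomialVal {c' : Fin (n + 1) → Fin (n + 1) → ℕ}
    (hc : ∀ i j, 0 < c i j) (hc' : ∀ i j, 0 < c' i j) (h : ∀ i j, (c' i j : ℤ) = c i j + d i j) :
    (matrixBeta c).withDensity (fun M => ENNReal.ofReal (monomialVal d M)) =
      ENNReal.ofReal (matrixBetaMoment c d) • matrixBeta c' := by
  have hmoment : 0 < matrixBetaMoment c d :=
    matrixBetaMoment_pos hc fun i j => by rw [← h]; exact_mod_cast hc' i j
  rw [matrixBeta, ← withDensity_mul _ (measurable_matrixBetaDensity c).ennreal_ofReal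
    (measurable_monomialVal d).ennreal_ofReal, matrixBeta,
    ← withDensity_smul' _ _ ENNReal.ofReal_ne_top]
  refine withDensity_congr_ae ((ae_pos_stochVolume n).mono fun M hM => ?_)
  rw [Pi.mul_apply, Pi.smul_apply, smul_eq_mul, ← ENNReal.ofReal_mul hmoment.le,
    ← ENNReal.ofReal_mul (matrixBetaDensity_nonneg c fun i j => (hM i j).le),
    matrixBetaDensity_eq_prod, matrixBetaDensity_eq_prod, monomialVal, matrixBetaMoment,
    ← Finset.prod_mul_distrib, ← Finset.prod_mul_distrib]
  congr 1
  exact Finset.prod_congr rfl fun i _ =>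
    dirichletDensity_mul_prod_zpow (hc i) (hc' i) (h i) fun j => (hM i j).ne'

theorem lintegral_monomialVal (hc : ∀ i j, 0 < c i j) (hd : ∀ i j, 0 < (c i j : ℤ) + d i j) :
    ∫⁻ M, ENNReal.ofReal (monomialVal d M) ∂matrixBeta c =
      ENNReal.ofReal (matrixBetaMoment c d) := by
  lift fun i j => (c i j : ℤ) + d i j to Fin (n + 1) → Fin (n + 1) → ℕ
    using fun i j => (hd i j).le with c' h
  have hc' : ∀ i j, 0 < c' i j := fun i j => by
    have := congrFun₂ h i j
    have := hd i j
    lia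
  have := isProbabilityMeasure_matrixBeta hc'
  rw [← setLIntegral_univ, ← withDensity_apply _ .univ,
    withDensity_matrixBeta_monomialVal hc hc' (congrFun₂ h), Measure.smul_apply, measure_univ,
    smul_eq_mul, mul_one]

theorem ae_nonneg_monomialVal (c : Fin (n + 1) → Fin (n + 1) → ℕ)
    (d : Fin (n + 1) → Fin (n + 1) → ℤ) : 0 ≤ᵐ[matrixBeta c] monomialVal d :=
  (ae_pos_matrixBeta c).mono fun _ hM => monomialVal_nonneg d fun i j => (hM i j).le

theorem integrable_monomialVal (hc : ∀ i j, 0 < c i j) (hd : ∀ i j, 0 < (c i j : ℤ) + d i j) :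
    Integrable (monomialVal d) (matrixBeta c) := by
  refine ⟨(measurable_monomialVal d).aestronglyMeasurable, ?_⟩
  rw [hasFiniteIntegral_iff_ofReal (ae_nonneg_monomialVal c d), lintegral_monomialVal hc hd]
  exact ENNReal.ofReal_lt_top

theorem integral_monomialVal (hc : ∀ i j, 0 < c i j) (hd : ∀ i j, 0 < (c i j : ℤ) + d i j) :
    ∫ M, monomialVal d M ∂matrixBeta c = matrixBetaMoment c d := by
  rw [integral_eq_lintegral_of_nonneg_ae (ae_nonneg_monomialVal c d)
    (measurable_monomialVal d).aestronglyMeasurable, lintegral_monomialVal hc hd,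
    ENNReal.toReal_ofReal (matrixBetaMoment_pos hc hd).le]

theorem transProd_eq_monomialVal {Q : Type} [Fintype Q] [DecidableEq Q] (M : Q → Q → ℝ)
    (x : List Q) : transProd M x = monomialVal (fun i j => (edgeCount i j x : ℤ)) M := by
  induction x with
  | nil => simp [transProd, monomialVal, edgeCount]
  | cons a w ih =>
    cases w with
    | nil => simp [transProd, monomialVal, edgeCount]
    | cons b w =>
      rw [transProd, ih, ← monomialVal_indicator a b M]
      simp only [monomialVal, edgeCount, zpow_natCast, pow_add, ← Finset.prod_mul_distrib]
      simp only [eq_comm (a := a), eq_comm (a := b)]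
      congr! 3 with i _ j
      split <;> simp

/-- The parameter of the posterior distribution given the word `x`, when the prior is the matrix
beta distribution with parameter `θ`. -/
def posteriorParam {Q : Type} [DecidableEq Q] (θ : Q → Q → ℕ) (x : List Q) (i j : Q) : ℕ :=
  θ i j + edgeCount i j x

theorem posteriorParam_pos {Q : Type} [DecidableEq Q] {θ : Q → Q → ℕ} (hθ : ∀ i j, 0 < θ i j)
    (x : List Q) (i j : Q) : 0 < posteriorParam θ x i j :=
  Nat.add_pos_left (hθ i j) _

theorem consistent_iff {Q : Type} [DecidableEq Q] {θ : Q → Q → ℕ} {P : PolyForm Q} {x : List Q} :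
    Consistent θ P x ↔ ∀ t ∈ P, ∀ i j, 0 < (posteriorParam θ x i j : ℤ) + t.2 i j := by
  simp only [Consistent, posteriorParam, Nat.cast_add, add_comm (edgeCount _ _ x : ℤ)]

theorem posterior_matrixBeta {θ : Fin (n + 1) → Fin (n + 1) → ℕ} (hθ : ∀ i j, 0 < θ i j)
    (q₀ : Fin (n + 1)) (w : List (Fin (n + 1))) :
    posterior (matrixBeta θ) q₀ (q₀ :: w) = matrixBeta (posteriorParam θ (q₀ :: w)) := by
  set d : Fin (n + 1) → Fin (n + 1) → ℤ := fun i j => edgeCount i j (q₀ :: w)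
  have hd : ∀ i j, 0 < (θ i j : ℤ) + d i j := fun i j => by
    have := hθ i j
    lia
  have hpath : ∀ M, pathProb q₀ M (q₀ :: w) = monomialVal d M := fun M => by
    rw [pathProb, if_pos rfl, transProd_eq_monomialVal]
  have hZ : ENNReal.ofReal (matrixBetaMoment θ d) ≠ 0 :=
    (ENNReal.ofReal_pos.2 (matrixBetaMoment_pos hθ hd)).ne'
  have hdensity : (fun M => ENNReal.ofReal (monomialVal d M) /
      ENNReal.ofReal (matrixBetaMoment θ d)) =
      (ENNReal.ofReal (matrixBetaMoment θ d))⁻¹ • fun M => ENNReal.ofReal (monomialVal d M) :=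
    funext fun _ => ENNReal.div_eq_inv_mul
  simp only [posterior, hpath, lintegral_monomialVal hθ hd]
  rw [hdensity, withDensity_smul' _ _ (ENNReal.inv_ne_top.2 hZ),
    withDensity_matrixBeta_monomialVal hθ (posteriorParam_pos hθ _)
      fun _ _ => Nat.cast_add _ _,
    smul_smul, ENNReal.inv_mul_cancel hZ ENNReal.ofReal_ne_top, one_smul]

end Moments

/-! ### Expectations of expressions -/

section Expressions

theorem Monomial.eval_eq_monomialVal {Q : Type} [Fintype Q] [DecidableEq Q] (ξ : Monomial Q)
    {M : Q → Q → ℝ} (hM : ∀ i j, M i j ≠ 0) : ξ.eval M = monomialVal ξ.exponent M := by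
  induction ξ with
  | var a b => exact (monomialVal_indicator a b M).symm
  | mul ξ η hξ hη => exact (congrArg₂ _ hξ hη).trans (monomialVal_add _ _ hM).symm
  | inv ξ hξ => exact ((one_div _).trans (congrArg _ hξ)).trans (monomialVal_neg _ M).symm

/-- The value at `M` of an expression in polynomial form. -/
noncomputable def PolyForm.val {Q : Type} [Fintype Q] (P : PolyForm Q) (M : Q → Q → ℝ) : ℝ :=
  (P.map fun t => t.1 * monomialVal t.2 M).sum

theorem PolyForm.val_append {Q : Type} [Fintype Q] (P P' : PolyForm Q) (M : Q → Q → ℝ) :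
    PolyForm.val (P ++ P') M = P.val M + P'.val M := by
  simp only [PolyForm.val, List.map_append, List.sum_append]

theorem PolyForm.val_neg {Q : Type} [Fintype Q] (P : PolyForm Q) (M : Q → Q → ℝ) :
    PolyForm.val (P.map fun t => (-t.1, t.2)) M = -P.val M := by
  rw [PolyForm.val, PolyForm.val, List.sum_neg, List.map_map, List.map_map]
  simp only [Function.comp_def, neg_mul]

theorem PolyForm.val_mul {Q : Type} [Fintype Q] (P P' : PolyForm Q) {M : Q → Q → ℝ}
    (hM : ∀ i j, M i j ≠ 0) :
    PolyForm.val (P.flatMap fun s => P'.map fun t => (s.1 * t.1, fun i j => s.2 i j + t.2 i j)) M =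
      P.val M * P'.val M := by
  have hmul : ∀ s t : ℝ × (Q → Q → ℤ),
      s.1 * t.1 * monomialVal (fun i j => s.2 i j + t.2 i j) M =
        s.1 * monomialVal s.2 M * (t.1 * monomialVal t.2 M) := fun s t => by
    rw [monomialVal_add _ _ hM, mul_mul_mul_comm]
  simp only [PolyForm.val, List.flatMap_def, List.map_flatten, List.sum_flatten, List.map_map,
    Function.comp_def, hmul, List.sum_map_mul_left, List.sum_map_mul_right]

theorem PSE.eval_eq_val {Q : Type} [Fintype Q] [DecidableEq Q] (φ : PSE Q) {M : Q → Q → ℝ}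
    (hM : ∀ i j, M i j ≠ 0) : φ.eval M = φ.polyForm.val M := by
  induction φ with
  | const κ => simp [PSE.eval, PSE.polyForm, PolyForm.val, monomialVal]
  | mono ξ => simp [PSE.eval, PSE.polyForm, PolyForm.val, ξ.eval_eq_monomialVal hM]
  | add φ ψ hφ hψ => rw [PSE.eval, hφ, hψ, PSE.polyForm, PolyForm.val_append]
  | sub φ ψ hφ hψ =>
    rw [PSE.eval, hφ, hψ, PSE.polyForm, PolyForm.val_append, PolyForm.val_neg, sub_eq_add_neg]
  | mul φ ψ hφ hψ => rw [PSE.eval, hφ, hψ, PSE.polyForm, PolyForm.val_mul _ _ hM]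

/-- The expectation of an expression in polynomial form under the matrix beta distribution with
parameter `c`, in terms of the moments of its monomials. It is meaningful when every monomial is
integrable. -/
noncomputable def PolyForm.matrixBetaMean {Q : Type} [Fintype Q] (P : PolyForm Q)
    (c : Q → Q → ℕ) : ℝ :=
  (P.map fun t => t.1 * matrixBetaMoment c t.2).sum

variable {n : ℕ} {c : Fin (n + 1) → Fin (n + 1) → ℕ}

theorem PolyForm.integrable_val (hc : ∀ i j, 0 < c i j) {P : PolyForm (Fin (n + 1))}
    (hP : ∀ t ∈ P, ∀ i j, 0 < (c i j : ℤ) + t.2 i j) : Integrable P.val (matrixBeta c) := by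
  induction P with
  | nil => exact integrable_zero _ _ _
  | cons t P ih =>
    exact ((integrable_monomialVal hc (List.forall_mem_cons.1 hP).1).const_mul _).add
      (ih (List.forall_mem_cons.1 hP).2)

theorem PolyForm.integral_val (hc : ∀ i j, 0 < c i j) {P : PolyForm (Fin (n + 1))}
    (hP : ∀ t ∈ P, ∀ i j, 0 < (c i j : ℤ) + t.2 i j) :
    ∫ M, P.val M ∂matrixBeta c = P.matrixBetaMean c := by
  induction P with
  | nil => exact integral_zero _ _
  | cons t P ih =>
    obtain ⟨ht, hP⟩ := List.forall_mem_cons.1 hP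
    calc ∫ M, PolyForm.val (t :: P) M ∂matrixBeta c
        = ∫ M, t.1 * monomialVal t.2 M + PolyForm.val P M ∂matrixBeta c := rfl
      _ = t.1 * matrixBetaMoment c t.2 + PolyForm.matrixBetaMean P c := by
        rw [integral_add ((integrable_monomialVal hc ht).const_mul _) (integrable_val hc hP),
          integral_const_mul, integral_monomialVal hc ht, ih hP]

theorem PSE.eval_ae_eq_val (φ : PSE (Fin (n + 1))) (c : Fin (n + 1) → Fin (n + 1) → ℕ) :
    φ.eval =ᵐ[matrixBeta c] φ.polyForm.val :=
  (ae_pos_matrixBeta c).mono fun _ hM => φ.eval_eq_val fun i j => (hM i j).ne'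

theorem PSE.integrable_eval (φ : PSE (Fin (n + 1))) (hc : ∀ i j, 0 < c i j)
    (hφ : ∀ t ∈ φ.polyForm, ∀ i j, 0 < (c i j : ℤ) + t.2 i j) :
    Integrable φ.eval (matrixBeta c) :=
  (PolyForm.integrable_val hc hφ).congr (φ.eval_ae_eq_val c).symm

theorem PSE.integral_eval (φ : PSE (Fin (n + 1))) (hc : ∀ i j, 0 < c i j)
    (hφ : ∀ t ∈ φ.polyForm, ∀ i j, 0 < (c i j : ℤ) + t.2 i j) :
    ∫ M, φ.eval M ∂matrixBeta c = φ.polyForm.matrixBetaMean c :=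
  (integral_congr_ae (φ.eval_ae_eq_val c)).trans (PolyForm.integral_val hc hφ)

theorem PSE.memLp_two_eval (φ : PSE (Fin (n + 1))) (hc : ∀ i j, 0 < c i j)
    (hφ : ∀ t ∈ φ.polyForm, ∀ i j, 0 < (c i j : ℤ) + t.2 i j)
    (hφφ : ∀ t ∈ (φ.mul φ).polyForm, ∀ i j, 0 < (c i j : ℤ) + t.2 i j) :
    MemLp φ.eval 2 (matrixBeta c) := by
  rw [memLp_two_iff_integrable_sq (φ.integrable_eval hc hφ).aestronglyMeasurable]
  simpa only [PSE.eval, ← sq] using (φ.mul φ).integrable_eval hc hφφ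

theorem PSE.variance_eval (φ : PSE (Fin (n + 1))) (hc : ∀ i j, 0 < c i j)
    (hφ : ∀ t ∈ φ.polyForm, ∀ i j, 0 < (c i j : ℤ) + t.2 i j)
    (hφφ : ∀ t ∈ (φ.mul φ).polyForm, ∀ i j, 0 < (c i j : ℤ) + t.2 i j) :
    variance φ.eval (matrixBeta c) =
      (φ.mul φ).polyForm.matrixBetaMean c - φ.polyForm.matrixBetaMean c ^ 2 := by
  have := isProbabilityMeasure_matrixBeta hc
  rw [variance_eq_sub (φ.memLp_two_eval hc hφ hφφ), ← φ.integral_eval hc hφ,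
    ← (φ.mul φ).integral_eval hc hφφ]
  simp only [PSE.eval, Pi.pow_apply, sq]

end Expressions

/-! ### Chebyshev's inequality -/

theorem one_sub_le_measure_Icc {Ω : Type*} [MeasurableSpace Ω] {μ : Measure Ω}
    [IsProbabilityMeasure μ] {X : Ω → ℝ} (hX : MemLp X 2 μ) {δ : ℝ} (hδ : 0 < δ) :
    ENNReal.ofReal (1 - δ) ≤
      μ {ω | X ω ∈ Set.Icc (μ[X] - √(variance X μ / δ)) (μ[X] + √(variance X μ / δ))} := by
  set r := √(variance X μ / δ)
  have hIcc : ∀ ω, X ω ∈ Set.Icc (μ[X] - r) (μ[X] + r) ↔ |X ω - μ[X]| ≤ r := fun ω => by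
    rw [abs_sub_comm, Set.mem_Icc_iff_abs_le]
  simp only [hIcc]
  rcases (variance_nonneg X μ).eq_or_lt with hvar | hvar
  · have hconst : ∀ᵐ ω ∂μ, |X ω - μ[X]| ≤ r := by
      filter_upwards [ae_eq_integral_of_variance_eq_zero hX hvar.symm] with ω hω
      rw [hω, sub_self, abs_zero]
      exact Real.sqrt_nonneg _
    rw [measure_congr (Filter.eventuallyEq_univ.2 hconst), measure_univ]
    exact ENNReal.ofReal_le_one.2 (by linarith)
  · have hr : 0 < r := Real.sqrt_pos.2 (by positivity)
    have htail : μ {ω | r ≤ |X ω - μ[X]|} ≤ ENNReal.ofReal δ := by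
      have h := meas_ge_le_variance_div_sq hX hr
      rwa [Real.sq_sqrt (by positivity), div_div_cancel₀ hvar.ne'] at h
    rw [ENNReal.ofReal_sub _ hδ.le, ENNReal.ofReal_one, tsub_le_iff_right, ← measure_univ (μ := μ)]
    calc μ Set.univ ≤ μ ({ω | |X ω - μ[X]| ≤ r} ∪ {ω | r ≤ |X ω - μ[X]|}) :=
          measure_mono fun ω _ => (le_total |X ω - ∫ ω, X ω ∂μ| r :)
      _ ≤ _ := (measure_union_le _ _).trans (by gcongr)

/-! ### Moments as quotients of permutation numbers -/

section PermutationNumbers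

theorem cast_descFactorial_eq_Gamma_div {c : ℕ} (hc : 0 < c) (k : ℕ) :
    ((c - 1 + k).descFactorial k : ℝ) = Real.Gamma (c + k : ℕ) / Real.Gamma c := by
  obtain ⟨a, rfl⟩ := Nat.exists_eq_add_of_le' hc
  have hfactorial := Nat.factorial_mul_descFactorial (Nat.le_add_left k a)
  rw [Nat.add_sub_cancel] at hfactorial
  rw [Nat.add_sub_cancel, Nat.add_right_comm, Nat.cast_succ, Nat.cast_succ,
    Real.Gamma_nat_eq_factorial, Real.Gamma_nat_eq_factorial, ← hfactorial, Nat.cast_mul,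
    mul_div_cancel_left₀ _ (by positivity)]

/-- The permutation number `P(c - 1 + |z|, |z|)` if `z > 0`, and `1` otherwise: the contribution of
a counter `c` with a positive exponent `z` to `h^l`. -/
def posPerm (c : ℕ) (z : ℤ) : ℕ := if 0 < z then (c - 1 + z.natAbs).descFactorial z.natAbs else 1

/-- The permutation number `P(c - 1, |z|)` if `z < 0`, and `1` otherwise: the contribution of
a counter `c` with a negative exponent `z` to `h^l`. -/
def negPerm (c : ℕ) (z : ℤ) : ℕ := if z < 0 then (c - 1).descFactorial z.natAbs else 1

theorem posPerm_div_negPerm {c : ℕ} {z : ℤ} (hc : 0 < c) (hz : 0 < (c : ℤ) + z) :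
    (posPerm c z : ℝ) / negPerm c z = Real.Gamma (c + z) / Real.Gamma c := by
  rcases le_or_gt 0 z with h | h
  · lift z to ℕ using h
    have hpos : posPerm c z = (c - 1 + z).descFactorial z := by
      rcases z.eq_zero_or_pos with rfl | hz
      · rfl
      · exact if_pos (by lia)
    rw [hpos, negPerm, if_neg (by lia), cast_descFactorial_eq_Gamma_div hc]
    simp
  · obtain ⟨k, rfl⟩ : ∃ k : ℕ, z = -k := ⟨z.natAbs, by lia⟩
    obtain ⟨b, rfl⟩ : ∃ b, c = b + k := Nat.exists_eq_add_of_le' (by lia)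
    have hb : 0 < b := by lia
    rw [posPerm, negPerm, if_neg (by lia), if_pos h, Int.natAbs_neg, Int.natAbs_natCast,
      Nat.sub_add_comm hb, cast_descFactorial_eq_Gamma_div hb]
    simp

theorem dirichletMoment_eq_posPerm_div_negPerm {ι : Type*} [Fintype ι] [Nonempty ι] {a : ι → ℕ}
    {d : ι → ℤ} (ha : ∀ j, 0 < a j) (hd : ∀ j, 0 < (a j : ℤ) + d j) :
    dirichletMoment a d =
      ((∏ j, (posPerm (a j) (d j) : ℝ)) / ∏ j, (negPerm (a j) (d j) : ℝ)) /
        (posPerm (∑ j, a j) (∑ j, d j) / negPerm (∑ j, a j) (∑ j, d j)) := by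
  have hsum : 0 < ∑ j, a j := Finset.sum_pos (fun j _ => ha j) Finset.univ_nonempty
  have hsum' : 0 < ((∑ j, a j : ℕ) : ℤ) + ∑ j, d j := by
    rw [Nat.cast_sum, ← Finset.sum_add_distrib]
    exact Finset.sum_pos (fun j _ => hd j) Finset.univ_nonempty
  simp only [← Finset.prod_div_distrib, posPerm_div_negPerm hsum hsum',
    posPerm_div_negPerm (ha _) (hd _)]
  rw [Finset.prod_div_distrib, dirichletMoment, multivariateBeta, multivariateBeta,
    div_div_div_comm, Finset.sum_add_distrib, Nat.cast_sum, Int.cast_sum]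

theorem matrixBetaMoment_eq_posPerm_div_negPerm {Q : Type*} [Fintype Q] {c : Q → Q → ℕ}
    {d : Q → Q → ℤ} (hc : ∀ i j, 0 < c i j) (hd : ∀ i j, 0 < (c i j : ℤ) + d i j) :
    matrixBetaMoment c d =
      ((∏ i, ∏ j, (posPerm (c i j) (d i j) : ℝ)) *
        ∏ i, (negPerm (∑ j, c i j) (∑ j, d i j) : ℝ)) /
      ((∏ i, (posPerm (∑ j, c i j) (∑ j, d i j) : ℝ)) *
        ∏ i, ∏ j, (negPerm (c i j) (d i j) : ℝ)) := by
  simp only [← Finset.prod_div_distrib, ← Finset.prod_mul_distrib]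
  refine Finset.prod_congr rfl fun i _ => ?_
  have : Nonempty Q := ⟨i⟩
  rw [dirichletMoment_eq_posPerm_div_negPerm (hc i) (hd i), div_div_div_eq,
    mul_comm (posPerm (∑ j, c i j) (∑ j, d i j) : ℝ)]

theorem multivariateBeta_add_single {ι : Type*} [Fintype ι] [DecidableEq ι] {x : ι → ℝ}
    (hx : ∀ j, 0 < x j) (s : ι) :
    multivariateBeta (x + Pi.single s 1) = multivariateBeta x * (x s / ∑ j, x j) := by
  have : Nonempty ι := ⟨s⟩
  have hsum : 0 < ∑ j, x j := Finset.sum_pos (fun j _ => hx j) Finset.univ_nonempty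
  have hGamma : ∀ j, Real.Gamma ((x + Pi.single s 1 : ι → ℝ) j) =
      Real.Gamma (x j) * if j = s then x s else 1 := fun j => by
    rcases eq_or_ne j s with rfl | hj
    · simp [Real.Gamma_add_one (hx j).ne', mul_comm]
    · simp [hj]
  have hsum_add : ∑ j, (x + Pi.single s 1 : ι → ℝ) j = ∑ j, x j + 1 := by
    simp [Finset.sum_add_distrib]
  rw [multivariateBeta, hsum_add, Real.Gamma_add_one hsum.ne',
    Finset.prod_congr rfl fun j _ => hGamma j, Finset.prod_mul_distrib, Finset.prod_ite_eq',
    if_pos (Finset.mem_univ s), mul_comm (∑ j, x j), mul_div_mul_comm, multivariateBeta]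

theorem dirichletMoment_add_single {ι : Type*} [Fintype ι] [DecidableEq ι] {a : ι → ℕ} {d : ι → ℤ}
    (ha : ∀ j, 0 < a j) (hd : ∀ j, 0 < (a j : ℤ) + d j) (s : ι) :
    dirichletMoment (a + Pi.single s 1) d =
      dirichletMoment a d *
        (((a s + d s) * ∑ j, (a j : ℝ)) / (a s * (∑ j, (a j : ℝ) + ∑ j, (d j : ℝ)))) := by
  have ha' : ∀ j, 0 < (a j : ℝ) := fun j => Nat.cast_pos.2 (ha j)
  have hd' : ∀ j, 0 < (a j : ℝ) + d j := fun j => by exact_mod_cast hd j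
  have hcast : (fun j => ((a + Pi.single s 1 : ι → ℕ) j : ℝ)) =
      (fun j => (a j : ℝ)) + Pi.single s 1 := by
    ext j
    rcases eq_or_ne j s with rfl | hj <;> simp [*]
  have hshift : (fun j => ((a + Pi.single s 1 : ι → ℕ) j : ℝ) + d j) =
      (fun j => (a j : ℝ) + d j) + Pi.single s 1 := by
    ext j
    rw [congrFun hcast j, Pi.add_apply, Pi.add_apply, add_right_comm]
  rw [dirichletMoment, hcast, hshift, multivariateBeta_add_single ha',
    multivariateBeta_add_single hd', mul_div_mul_comm, div_div_div_eq, Finset.sum_add_distrib,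
    mul_comm (_ + _) (a s : ℝ)]
  rfl

/-- The transition counts `c` after one more transition from `q` to `s`. -/
def addTransition {Q : Type*} [DecidableEq Q] (c : Q → Q → ℕ) (q s i j : Q) : ℕ :=
  c i j + if i = q ∧ j = s then 1 else 0

theorem addTransition_self {Q : Type*} [DecidableEq Q] (c : Q → Q → ℕ) (q s : Q) :
    addTransition c q s q s = c q s + 1 := by
  simp [addTransition]

theorem sum_addTransition {Q : Type*} [Fintype Q] [DecidableEq Q] (c : Q → Q → ℕ) (q s i : Q) :
    ∑ j, addTransition c q s i j = ∑ j, c i j + if i = q then 1 else 0 := by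
  rcases eq_or_ne i q with rfl | hi <;> simp [addTransition, Finset.sum_add_distrib, *]

theorem matrixBetaMoment_addTransition {Q : Type*} [Fintype Q] [DecidableEq Q] {c : Q → Q → ℕ}
    {d : Q → Q → ℤ} (hc : ∀ i j, 0 < c i j) (hd : ∀ i j, 0 < (c i j : ℤ) + d i j) (q s : Q) :
    matrixBetaMoment (addTransition c q s) d =
      matrixBetaMoment c d *
        (((c q s + d q s) * ∑ j, (c q j : ℝ)) /
          (c q s * (∑ j, (c q j : ℝ) + ∑ j, (d q j : ℝ)))) := by
  set factor : ℝ := _ / (c q s * (∑ j, (c q j : ℝ) + ∑ j, (d q j : ℝ)))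
  have hrow : ∀ i, dirichletMoment (addTransition c q s i) (d i) =
      dirichletMoment (c i) (d i) * if i = q then factor else 1 := fun i => by
    rcases eq_or_ne i q with rfl | hi
    · rw [if_pos rfl, ← dirichletMoment_add_single (hc i) (hd i)]
      congr 1
      ext j
      simp [addTransition, Pi.single_apply]
    · have hrow_eq : addTransition c q s i = c i := by
        ext j
        simp [addTransition, hi]
      rw [if_neg hi, mul_one, hrow_eq]
  simp only [matrixBetaMoment, hrow, Finset.prod_mul_distrib, Finset.prod_ite_eq',
    Finset.mem_univ, if_true]

end PermutationNumbers

/-! ### Values of terms -/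

namespace Term

variable {R : Type} (v : R → ℕ)

theorem eval_ofNat (k : ℕ) : (ofNat k : Term R).eval v = k := by
  induction k with
  | zero => rfl
  | succ k ih => rw [ofNat, eval, ih, eval]

theorem eval_addInt (t : Term R) (z : ℤ) : (t.addInt z).eval v = ((t.eval v : ℤ) + z).toNat := by
  simp only [addInt, eval, eval_ofNat]
  lia

theorem eval_prod (l : List (Term R)) : (prod l).eval v = (l.map (eval v)).prod := by
  induction l with
  | nil => rfl
  | cons t l ih => rw [prod, eval, ih, List.map_cons, List.prod_cons]

theorem eval_prod_map_finRange {m : ℕ} (t : Fin m → Term R) :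
    (prod ((List.finRange m).map t)).eval v = ∏ i, (t i).eval v := by
  rw [eval_prod, List.map_map, Fin.prod_univ_def]
  rfl

theorem eval_prod_map_filter_finRange {m : ℕ} (p : Fin m → Prop) [DecidablePred p]
    (t : Fin m → Term R) :
    (prod (((List.finRange m).filter fun i => p i).map t)).eval v =
      ∏ i, if p i then (t i).eval v else 1 := by
  rw [eval_prod, List.map_map, Fin.prod_univ_def, List.prod_map_ite, List.map_const',
    List.prod_replicate, one_pow, mul_one]
  rfl

theorem eval_perm (t : Term R) (k : ℕ) : (t.perm k).eval v = (t.eval v).descFactorial k := by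
  rw [perm, eval_prod, Nat.descFactorial_eq_prod_range, List.map_map]
  simp only [Function.comp_def, eval, eval_ofNat]
  rfl

theorem eval_rename {R' : Type} (f : R → R') (v : R' → ℕ) (t : Term R) :
    (t.rename f).eval v = t.eval (v ∘ f) := by
  induction t with
  | zero | one | reg => rfl
  | add s t hs ht | sub s t hs ht | mul s t hs ht | div s t hs ht => rw [rename, eval, hs, ht, eval]

end Term

theorem Atom.holds_rename {R R' : Type} (f : R → R') (v : R' → ℕ) (a : Atom R) :
    (a.rename f).Holds v ↔ a.Holds (v ∘ f) := by
  cases a <;> simp only [Atom.rename, Atom.Holds, Term.eval_rename]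

namespace ExpMonitor

variable {n p : ℕ}

theorem eval_numH {R : Type} (d : Fin (n + 1) → Fin (n + 1) → ℤ)
    (c : Fin (n + 1) → Fin (n + 1) → Term R) (r : Fin (n + 1) → Term R) (v : R → ℕ) :
    (numH d c r).eval v = (∏ i, ∏ j, posPerm ((c i j).eval v) (d i j)) *
      ∏ i, negPerm ((r i).eval v) (rowExp d i) := by
  simp only [numH, Term.eval, Term.eval_prod_map_finRange, Term.eval_prod_map_filter_finRange,
    Term.eval_perm, Term.eval_ofNat, posPerm, negPerm]

theorem eval_denH {R : Type} (d : Fin (n + 1) → Fin (n + 1) → ℤ)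
    (c : Fin (n + 1) → Fin (n + 1) → Term R) (r : Fin (n + 1) → Term R) (v : R → ℕ) :
    (denH d c r).eval v = (∏ i, posPerm ((r i).eval v) (rowExp d i)) *
      ∏ i, ∏ j, negPerm ((c i j).eval v) (d i j) := by
  simp only [denH, Term.eval, Term.eval_prod_map_finRange, Term.eval_prod_map_filter_finRange,
    Term.eval_perm, Term.eval_ofNat, posPerm, negPerm]

theorem eval_cntNext (v : ExpReg n p → ℕ) (q s i j : Fin (n + 1)) :
    (cntNext q s i j).eval v = addTransition (fun i j => v (.cnt i j)) q s i j := by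
  rw [cntNext, addTransition]
  split_ifs <;> rfl

theorem eval_rowNext (v : ExpReg n p → ℕ) (q i : Fin (n + 1)) :
    (rowNext q i).eval v = v (.row i) + if i = q then 1 else 0 := by
  rw [rowNext]
  split_ifs <;> rfl

end ExpMonitor

/-! ### Runs of deterministic monitors -/

namespace RegisterMonitor

variable {S L : Type} {A : RegisterMonitor S L}

theorem step_eq_pure {s : S} {v : A.R → ℕ} {τ : Test A.R} {γ : Update A.R}
    (hτ : τ.Holds v) (hγ : A.trans s τ = some (PMF.pure γ)) :
    A.step s v = PMF.pure (γ.apply v) := by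
  have hchoose : (A.unique s v).choose = τ :=
    (A.unique s v).unique (A.unique s v).choose_spec.1 ⟨hτ, by rw [hγ]; rfl⟩
  have hget : ∀ h, (A.trans s (A.unique s v).choose).get h = PMF.pure γ := by
    rw [hchoose, hγ]
    exact fun _ => rfl
  rw [step, hget, PMF.pure_map]

theorem run_eq_pure_foldl {f : (A.R → ℕ) → S → A.R → ℕ}
    (hf : ∀ s v, A.step s v = PMF.pure (f v s)) (w : List S) (v : A.R → ℕ) :
    A.run w v = PMF.pure (w.foldl f v) := by
  induction w generalizing v with
  | nil => rfl
  | cons s w ih => rw [run, hf, PMF.pure_bind, ih, List.foldl_cons]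

theorem semantics_eq_pure_foldl {f : (A.R → ℕ) → S → A.R → ℕ}
    (hf : ∀ s v, A.step s v = PMF.pure (f v s)) (w : List S) :
    A.semantics w = PMF.pure (A.out (w.foldl f fun _ => 0)) := by
  rw [semantics, run_eq_pure_foldl hf, PMF.pure_map]

end RegisterMonitor

open Classical in
/-- The successor of the valuation `v` on the input symbol `s` in a deterministic monitor given by
the decision table `at_`, `upd`. -/
noncomputable def tableNext {S R ι : Type} (at_ : S → ι → Atom R)
    (upd : S → (ι → Bool) → Update R) (v : R → ℕ) (s : S) : R → ℕ :=
  (upd s fun k => decide ((at_ s k).Holds v)).apply v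

open Classical in
theorem tableMonitor_step {S L R ι : Type} [Finite R] [Fintype ι] (out : (R → ℕ) → L)
    (at_ : S → ι → Atom R) (upd : S → (ι → Bool) → Update R) (s : S) (v : R → ℕ) :
    (tableMonitor out at_ upd).step s v = PMF.pure (tableNext at_ upd v s) := by
  set b : ι → Bool := fun k => decide ((at_ s k).Holds v) with hb
  have hholds : Test.Holds v (tableTest (at_ s) b) :=
    (tableTest_holds _ _ _).2 fun k => decide_eq_true_iff
  have hex : ∃ b', tableTest (at_ s) b = tableTest (at_ s) b' := ⟨b, rfl⟩
  have hchoose : hex.choose = b := by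
    have h : Test.Holds v (tableTest (at_ s) hex.choose) := hex.choose_spec ▸ hholds
    funext k
    rw [Bool.eq_iff_iff, (tableTest_holds _ _ _).1 h k, hb, decide_eq_true_iff]
  have htrans : (tableMonitor out at_ upd).trans s (tableTest (at_ s) b) =
      some (PMF.pure (upd s b)) :=
    (dif_pos hex).trans (congrArg (fun b => some (PMF.pure (upd s b))) hchoose)
  exact RegisterMonitor.step_eq_pure (A := tableMonitor out at_ upd) hholds htrans

theorem tableMonitor_semantics {S L R ι : Type} [Finite R] [Fintype ι] (out : (R → ℕ) → L)
    (at_ : S → ι → Atom R) (upd : S → (ι → Bool) → Update R) (w : List S) :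
    (tableMonitor out at_ upd).semantics w =
      PMF.pure (out (w.foldl (tableNext at_ upd) fun _ => 0)) :=
  RegisterMonitor.semantics_eq_pure_foldl (tableMonitor_step out at_ upd) w

open Classical in
theorem tableNext_sumElim {S R₁ R₂ ι₁ ι₂ : Type} (at₁ : S → ι₁ → Atom R₁) (at₂ : S → ι₂ → Atom R₂)
    (upd₁ : S → (ι₁ → Bool) → Update R₁) (upd₂ : S → (ι₂ → Bool) → Update R₂) (v₁ : R₁ → ℕ)
    (v₂ : R₂ → ℕ) (s : S) :
    tableNext (fun s => Sum.elim (fun k => (at₁ s k).rename Sum.inl)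
        fun k => (at₂ s k).rename Sum.inr)
      (fun s b => Sum.elim (fun r => (upd₁ s (b ∘ Sum.inl) r).rename Sum.inl)
        fun r => (upd₂ s (b ∘ Sum.inr) r).rename Sum.inr)
      (Sum.elim v₁ v₂) s =
    Sum.elim (tableNext at₁ upd₁ v₁ s) (tableNext at₂ upd₂ v₂ s) := by
  have hinl : (fun k => decide (((at₁ s k).rename Sum.inl).Holds (Sum.elim v₁ v₂))) =
      fun k => decide ((at₁ s k).Holds v₁) :=
    funext fun k => decide_eq_decide.2 (Atom.holds_rename _ _ _)
  have hinr : (fun k => decide (((at₂ s k).rename Sum.inr).Holds (Sum.elim v₁ v₂))) =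
      fun k => decide ((at₂ s k).Holds v₂) :=
    funext fun k => decide_eq_decide.2 (Atom.holds_rename _ _ _)
  funext r
  rcases r with r | r
  · exact (Term.eval_rename _ _ _).trans (congrArg (fun b => (upd₁ s b r).eval v₁) hinl)
  · exact (Term.eval_rename _ _ _).trans (congrArg (fun b => (upd₂ s b r).eval v₂) hinr)

theorem foldl_tableNext_sumElim {S R₁ R₂ ι₁ ι₂ : Type} (at₁ : S → ι₁ → Atom R₁)
    (at₂ : S → ι₂ → Atom R₂) (upd₁ : S → (ι₁ → Bool) → Update R₁)
    (upd₂ : S → (ι₂ → Bool) → Update R₂) (w : List S) :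
    w.foldl (tableNext (fun s => Sum.elim (fun k => (at₁ s k).rename Sum.inl)
        fun k => (at₂ s k).rename Sum.inr)
      fun s b => Sum.elim (fun r => (upd₁ s (b ∘ Sum.inl) r).rename Sum.inl)
        fun r => (upd₂ s (b ∘ Sum.inr) r).rename Sum.inr) (fun _ => 0) =
    Sum.elim (w.foldl (tableNext at₁ upd₁) fun _ => 0)
      (w.foldl (tableNext at₂ upd₂) fun _ => 0) := by
  rw [← Sum.elim_lam_const_lam_const (0 : ℕ)]
  exact w.foldl_hom₂ Sum.elim _ _ _ _ _ fun v₁ v₂ s =>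
    (tableNext_sumElim at₁ at₂ upd₁ upd₂ v₁ v₂ s).symm

/-! ### The run of `BayesExpMonitor` -/

theorem edgeCount_append_singleton {Q : Type} [DecidableEq Q] (i j q s : Q) (w : List Q) :
    edgeCount i j (w ++ [q] ++ [s]) =
      edgeCount i j (w ++ [q]) + if i = q ∧ j = s then 1 else 0 := by
  induction w with
  | nil => simp [edgeCount, eq_comm]
  | cons a w ih =>
    cases w with
    | nil => simp [edgeCount, eq_comm]
    | cons b w =>
      simp only [List.cons_append, edgeCount] at ih ⊢
      rw [ih, add_assoc]

theorem posteriorParam_append_singleton {Q : Type} [DecidableEq Q] (θ : Q → Q → ℕ) (w : List Q)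
    (q s : Q) : posteriorParam θ (w ++ [q] ++ [s]) =
      addTransition (posteriorParam θ (w ++ [q])) q s := by
  ext i j
  rw [posteriorParam, edgeCount_append_singleton, ← add_assoc, addTransition, posteriorParam]

theorem le_addTransition {Q : Type*} [DecidableEq Q] (c : Q → Q → ℕ) (q s i j : Q) :
    c i j ≤ addTransition c q s i j :=
  Nat.le_add_right _ _

namespace ExpMonitor

variable {n p : ℕ} {θ : Fin (n + 1) → Fin (n + 1) → ℕ}
  {d : Fin p → Fin (n + 1) → Fin (n + 1) → ℤ}

theorem forall_pos_add_minExp_iff {c : Fin (n + 1) → Fin (n + 1) → ℕ} (hc : ∀ i j, 0 < c i j) :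
    (∀ i j, (∃ l, d l i j ≠ 0) → 0 < (c i j : ℤ) + minExp d i j) ↔
      ∀ l i j, 0 < (c i j : ℤ) + d l i j := by
  constructor
  · intro h l i j
    rcases eq_or_ne (d l i j) 0 with hd | hd
    · have := hc i j
      lia
    · have hpos := h i j ⟨l, hd⟩
      have hmin : minExp d i j ≤ d l i j := ciInf_le (Set.finite_range _).bddBelow l
      lia
  · rintro h i j ⟨l, -⟩
    have : Nonempty (Fin p) := ⟨l⟩
    obtain ⟨m, hm⟩ := exists_eq_ciInf_of_finite (f := fun l => d l i j)
    rw [minExp, ← hm]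
    exact h m i j

/-- One call of `BayesExpMonitor`, as a function on the valuations of its registers. -/
noncomputable def next (θ : Fin (n + 1) → Fin (n + 1) → ℕ)
    (d : Fin p → Fin (n + 1) → Fin (n + 1) → ℤ) :
    (ExpReg n p → ℕ) → Fin (n + 1) → ExpReg n p → ℕ :=
  tableNext (atoms d) (update θ d)

theorem next_of_prev_eq_zero {v : ExpReg n p → ℕ} (hv : v .prev = 0) (s : Fin (n + 1)) :
    next θ d v s = (initUpdate θ s).apply v := by
  rw [next, tableNext, update, dif_neg]
  rintro ⟨q, hq⟩
  simp [atoms, Atom.Holds, Term.eval, Term.eval_ofNat, hv] at hq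

open Classical in
theorem next_of_prev_eq {v : ExpReg n p → ℕ} {q : Fin (n + 1)} (hv : v .prev = q + 1)
    (s : Fin (n + 1)) :
    next θ d v s = (nextUpdate d q s (decide (v .active = 1))
      (decide (∀ i j, (∃ l, d l i j ≠ 0) →
        0 < (((cntNext q s i j).eval v : ℕ) : ℤ) + minExp d i j))).apply v := by
  have hprev : ∀ q', (atoms d s (.prevIs q')).Holds v ↔ q' = q := fun q' => by
    rw [atoms, Atom.Holds, Term.eval, Term.eval_ofNat, hv, Fin.ext_iff]
    lia
  have hactive : (atoms d s .isActive).Holds v ↔ v .active = 1 := Iff.rfl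
  have hconsistent : ∀ i j, (atoms d s (.consistent q i j)).Holds v ↔
      0 < (((cntNext q s i j).eval v : ℕ) : ℤ) + minExp d i j := fun i j => by
    rw [atoms, Atom.Holds, Term.eval_addInt, Term.eval]
    lia
  have hex : ∃ q', decide ((atoms d s (.prevIs q')).Holds v) = true :=
    ⟨q, decide_eq_true ((hprev q).2 rfl)⟩
  have hchoose : hex.choose = q := (hprev _).1 (of_decide_eq_true hex.choose_spec)
  rw [next, tableNext, update, dif_pos hex, hchoose]
  simp only [decide_eq_true_eq, hconsistent, hactive]

/-- The registers `prev`, `cnt` and `row` when the previous state is `q` and the counters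
`c̄_{ij}` are `c i j`. -/
structure Counters (c : Fin (n + 1) → Fin (n + 1) → ℕ) (q : Fin (n + 1)) (v : ExpReg n p → ℕ) :
    Prop where
  prev : v .prev = q + 1
  cnt : ∀ i j, v (.cnt i j) = c i j
  row : ∀ i, v (.row i) = ∑ j, c i j

namespace Counters

variable {c : Fin (n + 1) → Fin (n + 1) → ℕ} {q : Fin (n + 1)} {v : ExpReg n p → ℕ}

theorem eval_cntNext (h : Counters c q v) (s i j : Fin (n + 1)) :
    (cntNext q s i j).eval v = addTransition c q s i j := by
  rw [ExpMonitor.eval_cntNext, funext₂ h.cnt]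

theorem eval_rowNext (h : Counters c q v) (s i : Fin (n + 1)) :
    (rowNext q i).eval v = ∑ j, addTransition c q s i j := by
  rw [ExpMonitor.eval_rowNext, h.row, sum_addTransition]

open Classical in
theorem next_eq (h : Counters c q v) (hc : ∀ i j, 0 < c i j) (s : Fin (n + 1)) :
    ExpMonitor.next θ d v s = (nextUpdate d q s (decide (v .active = 1))
      (decide (∀ l i j, 0 < (addTransition c q s i j : ℤ) + d l i j))).apply v := by
  simp only [next_of_prev_eq h.prev, h.eval_cntNext, forall_pos_add_minExp_iff fun i j =>
    (hc i j).trans_le (le_addTransition c q s i j)]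

theorem next (h : Counters c q v) (hc : ∀ i j, 0 < c i j) (s : Fin (n + 1)) :
    Counters (addTransition c q s) s (ExpMonitor.next θ d v s) := by
  rw [h.next_eq hc]
  exact ⟨Term.eval_ofNat v (s + 1), h.eval_cntNext s, h.eval_rowNext s⟩

theorem active_next_iff (h : Counters c q v) (hc : ∀ i j, 0 < c i j) (s : Fin (n + 1)) :
    ExpMonitor.next θ d v s .active = 1 ↔
      v .active = 1 ∨ ∀ l i j, 0 < (addTransition c q s i j : ℤ) + d l i j := by
  rw [h.next_eq hc, Update.apply, nextUpdate, ← Bool.decide_or]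
  split_ifs with hact <;> simpa [Term.eval] using hact

theorem ratio_next_of_active (h : Counters c q v) (hc : ∀ i j, 0 < c i j) (hv : v .active = 1)
    {l : Fin p} (hd : ∀ i j, 0 < (c i j : ℤ) + d l i j)
    (hratio : (v (.num l) : ℝ) / v (.den l) = matrixBetaMoment c (d l)) (s : Fin (n + 1)) :
    (ExpMonitor.next θ d v s (.num l) : ℝ) / ExpMonitor.next θ d v s (.den l) =
      matrixBetaMoment (addTransition c q s) (d l) := by
  have hrow : 0 < ((∑ j, c q j : ℕ) : ℤ) + rowExp (d l) q := by
    rw [rowExp, Nat.cast_sum, ← Finset.sum_add_distrib]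
    exact Finset.sum_pos (fun j _ => hd q j) Finset.univ_nonempty
  have hrow_cast : ((∑ j, c q j : ℕ) : ℝ) + (rowExp (d l) q : ℝ) =
      ∑ j, (c q j : ℝ) + ∑ j, (d l q j : ℝ) := by
    rw [rowExp, Nat.cast_sum, Int.cast_sum]
  have cast_toNat : ∀ {a : ℕ} {z : ℤ}, 0 < (a : ℤ) + z →
      ((((a : ℤ) + z).toNat : ℕ) : ℝ) = a + z := fun hz => by
    exact_mod_cast congrArg (Int.cast : ℤ → ℝ) (Int.toNat_of_nonneg hz.le)
  rw [h.next_eq hc, decide_eq_true hv]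
  simp only [Update.apply, nextUpdate, if_true, Term.eval, Term.eval_addInt, h.eval_cntNext,
    h.eval_rowNext s, addTransition_self, sum_addTransition, Nat.add_sub_cancel, Nat.cast_mul,
    cast_toNat (hd q s), cast_toNat hrow]
  rw [matrixBetaMoment_addTransition hc hd, ← hratio, mul_div_mul_comm, hrow_cast, Nat.cast_sum]

theorem ratio_next_of_not_active (h : Counters c q v) (hc : ∀ i j, 0 < c i j)
    (hv : v .active ≠ 1) {s : Fin (n + 1)}
    (hd : ∀ l i j, 0 < (addTransition c q s i j : ℤ) + d l i j) (l : Fin p) :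
    (ExpMonitor.next θ d v s (.num l) : ℝ) / ExpMonitor.next θ d v s (.den l) =
      matrixBetaMoment (addTransition c q s) (d l) := by
  rw [h.next_eq hc, decide_eq_false hv, decide_eq_true hd, matrixBetaMoment_eq_posPerm_div_negPerm
    (fun i j => (hc i j).trans_le (le_addTransition c q s i j)) (hd l)]
  simp only [Update.apply, nextUpdate, if_true, Bool.false_eq_true, if_false, eval_numH,
    eval_denH, h.eval_cntNext, h.eval_rowNext s, Nat.cast_mul, Nat.cast_prod, rowExp]

end Counters

/-- The registers when the previous state is `q`, the counters `c̄_{ij}` are `c i j` and `k` symbols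
have been read. As soon as all moments with exponents `d l` exist, `h^l` is the `l`-th of them. -/
structure Invariant (d : Fin p → Fin (n + 1) → Fin (n + 1) → ℤ) (c : Fin (n + 1) → Fin (n + 1) → ℕ)
    (q : Fin (n + 1)) (k : ℕ) (v : ExpReg n p → ℕ) : Prop extends Counters c q v where
  active : v .active = 1 ↔ 2 ≤ k ∧ ∀ l i j, 0 < (c i j : ℤ) + d l i j
  ratio : v .active = 1 → ∀ l, (v (.num l) : ℝ) / v (.den l) = matrixBetaMoment c (d l)

theorem invariant_init (θ : Fin (n + 1) → Fin (n + 1) → ℕ)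
    (d : Fin p → Fin (n + 1) → Fin (n + 1) → ℤ) (q : Fin (n + 1)) :
    Invariant d θ q 1 (next θ d (fun _ => 0) q) := by
  rw [next_of_prev_eq_zero rfl]
  refine ⟨⟨?_, ?_, ?_⟩, ?_, ?_⟩ <;> simp [Update.apply, initUpdate, Term.eval, Term.eval_ofNat]

theorem Invariant.next {c : Fin (n + 1) → Fin (n + 1) → ℕ} {q : Fin (n + 1)} {k : ℕ}
    {v : ExpReg n p → ℕ} (h : Invariant d c q k v) (hc : ∀ i j, 0 < c i j) (hk : 1 ≤ k)
    (s : Fin (n + 1)) :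
    Invariant d (addTransition c q s) s (k + 1) (ExpMonitor.next θ d v s) := by
  have hle := le_addTransition c q s
  have hactive : ExpMonitor.next θ d v s .active = 1 ↔
      ∀ l i j, 0 < (addTransition c q s i j : ℤ) + d l i j := by
    rw [h.active_next_iff hc, or_iff_right_of_imp]
    intro hv l i j
    have := (h.active.1 hv).2 l i j
    have := hle i j
    lia
  refine ⟨h.toCounters.next hc s, hactive.trans (and_iff_right (by lia)).symm, fun hnext l => ?_⟩
  by_cases hv : v .active = 1
  · exact h.ratio_next_of_active hc hv ((h.active.1 hv).2 l) (h.ratio hv l) s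
  · exact h.ratio_next_of_not_active hc hv (hactive.1 hnext) l

theorem invariant_run (hθ : ∀ i j, 0 < θ i j) (d : Fin p → Fin (n + 1) → Fin (n + 1) → ℤ)
    (w : List (Fin (n + 1))) (q : Fin (n + 1)) :
    Invariant d (posteriorParam θ (w ++ [q])) q (w ++ [q]).length
      ((w ++ [q]).foldl (next θ d) fun _ => 0) := by
  induction w using List.reverseRecOn generalizing q with
  | nil => exact invariant_init θ d q
  | append_singleton w s ih =>
    rw [posteriorParam_append_singleton, List.foldl_append, List.length_append]
    exact (ih s).next (posteriorParam_pos hθ _) (by simp) q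

/-- The value of `BayesExpMonitor` for the polynomial form `P` after reading the word `x`. -/
noncomputable def valueAfter (θ : Fin (n + 1) → Fin (n + 1) → ℕ) (P : PolyForm (Fin (n + 1)))
    (x : List (Fin (n + 1))) : Option ℝ :=
  value P (x.foldl (next θ fun l => (P.get l).2) fun _ => 0)

open Classical in
theorem valueAfter_eq_ite (hθ : ∀ i j, 0 < θ i j) (P : PolyForm (Fin (n + 1)))
    {x : List (Fin (n + 1))} (hx : x ≠ []) :
    valueAfter θ P x = if 2 ≤ x.length ∧ Consistent θ P x then
      some (P.matrixBetaMean (posteriorParam θ x)) else none := by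
  obtain ⟨w, q, rfl⟩ : ∃ w q, x = w ++ [q] := ⟨_, _, (List.dropLast_append_getLast hx).symm⟩
  have hrun := invariant_run hθ (fun l => (P.get l).2) w q
  have hactive := hrun.active
  rw [← List.forall_mem_iff_get (p := fun t : ℝ × (Fin (n + 1) → Fin (n + 1) → ℤ) =>
    ∀ i j, 0 < (posteriorParam θ (w ++ [q]) i j : ℤ) + t.2 i j), ← consistent_iff] at hactive
  rw [valueAfter, value]
  refine if_ctx_congr hactive (fun hr => ?_) fun _ => rfl
  simp only [hrun.ratio (hactive.2 hr)]
  rw [PolyForm.matrixBetaMean, ← Fin.sum_univ_fun_getElem]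
  rfl

end ExpMonitor

/-! ### The output of `BayesConfIntMonitor` -/

section ConfInt

variable {n : ℕ} {θ : Fin (n + 1) → Fin (n + 1) → ℕ} {q₀ : Fin (n + 1)}

theorem bayesConfIntMonitor_semantics (φ : PSE (Fin (n + 1)))
    (θ : Fin (n + 1) → Fin (n + 1) → ℕ) (δ : ℝ) (x : List (Fin (n + 1))) :
    (bayesConfIntMonitor φ θ δ).semantics x = PMF.pure (confInt δ
      (ExpMonitor.valueAfter θ φ.polyForm x) (ExpMonitor.valueAfter θ (φ.mul φ).polyForm x)) := by
  rw [bayesConfIntMonitor, tableMonitor_semantics, foldl_tableNext_sumElim]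
  rfl

open Classical in
theorem bayesConfIntMonitor_semantics_eq_ite (hθ : ∀ i j, 0 < θ i j) (φ : PSE (Fin (n + 1)))
    (δ : ℝ) {x : List (Fin (n + 1))} (hx : x ≠ []) :
    (bayesConfIntMonitor φ θ δ).semantics x = PMF.pure (if Ready θ φ x then
      confInt δ (some (φ.polyForm.matrixBetaMean (posteriorParam θ x)))
        (some ((φ.mul φ).polyForm.matrixBetaMean (posteriorParam θ x))) else none) := by
  rw [bayesConfIntMonitor_semantics, ExpMonitor.valueAfter_eq_ite hθ _ hx,
    ExpMonitor.valueAfter_eq_ite hθ _ hx, Ready]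
  split_ifs <;> first | rfl | tauto

theorem bayesConfIntMonitor_semantics_of_not_ready (hθ : ∀ i j, 0 < θ i j) (φ : PSE (Fin (n + 1)))
    (δ : ℝ) {x : List (Fin (n + 1))} (hx : x ≠ []) (h : ¬ Ready θ φ x) :
    (bayesConfIntMonitor φ θ δ).semantics x = PMF.pure none := by
  rw [bayesConfIntMonitor_semantics_eq_ite hθ φ δ hx, if_neg h]

theorem bayesConfIntMonitor_semantics_of_ready (hθ : ∀ i j, 0 < θ i j) (φ : PSE (Fin (n + 1)))
    (δ : ℝ) {x : List (Fin (n + 1))} (hx : x ≠ []) (h : Ready θ φ x) :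
    (bayesConfIntMonitor φ θ δ).semantics x = PMF.pure (some
      (∫ M, φ.eval M ∂matrixBeta (posteriorParam θ x) -
          √(variance φ.eval (matrixBeta (posteriorParam θ x)) / δ),
        ∫ M, φ.eval M ∂matrixBeta (posteriorParam θ x) +
          √(variance φ.eval (matrixBeta (posteriorParam θ x)) / δ))) := by
  have hφ := consistent_iff.1 h.2.1
  rw [bayesConfIntMonitor_semantics_eq_ite hθ φ δ hx, if_pos h, confInt,
    φ.variance_eval (posteriorParam_pos hθ x) hφ (consistent_iff.1 h.2.2),
    φ.integral_eval (posteriorParam_pos hθ x) hφ]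

theorem coverProb_of_semantics_eq_pure (μ : Measure (Fin (n + 1) → Fin (n + 1) → ℝ))
    (q₀ : Fin (n + 1)) (φ : PSE (Fin (n + 1))) {A : RegisterMonitor (Fin (n + 1)) Verdict}
    {x : List (Fin (n + 1))} {I : Verdict} (h : A.semantics x = PMF.pure I) :
    coverProb μ q₀ φ A x = posterior μ q₀ x {M | φ.eval M ∈ I.toSet} := by
  rw [coverProb, h, tsum_eq_single I fun J hJ => by rw [PMF.pure_apply_of_ne _ _ hJ, zero_mul],
    PMF.pure_apply_self, one_mul]

theorem MarkovChain.IsPath.exists_eq_cons {C : MarkovChain (n + 1)} {x : List (Fin (n + 1))}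
    (hx : C.IsPath x) (hC : C.StartsAt q₀) : ∃ w, x = q₀ :: w := by
  obtain ⟨hne, hpos⟩ := hx
  obtain ⟨a, w, rfl⟩ := List.exists_cons_of_ne_nil hne
  suffices a = q₀ from ⟨w, by rw [this]⟩
  by_contra ha
  have hmarginal := hpos 0 (by simp)
  rw [MarkovChain.marginal, hC] at hmarginal
  simp [ha] at hmarginal

theorem posterior_matrixBeta_of_isPath (hθ : ∀ i j, 0 < θ i j) {C : MarkovChain (n + 1)}
    (hC : C.StartsAt q₀) {x : List (Fin (n + 1))} (hx : C.IsPath x) :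
    posterior (matrixBeta θ) q₀ x = matrixBeta (posteriorParam θ x) := by
  obtain ⟨w, rfl⟩ := hx.exists_eq_cons hC
  exact posterior_matrixBeta hθ q₀ w

theorem memLp_two_eval_of_ready (hθ : ∀ i j, 0 < θ i j) {φ : PSE (Fin (n + 1))}
    {x : List (Fin (n + 1))} (h : Ready θ φ x) :
    MemLp φ.eval 2 (matrixBeta (posteriorParam θ x)) :=
  φ.memLp_two_eval (posteriorParam_pos hθ x) (consistent_iff.1 h.2.1) (consistent_iff.1 h.2.2)

theorem solvesBayesianMonitoring_bayesConfIntMonitor (hθ : ∀ i j, 0 < θ i j) (q₀ : Fin (n + 1))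
    (φ : PSE (Fin (n + 1))) {δ : ℝ} (hδ : 0 < δ) :
    SolvesBayesianMonitoring (matrixBeta θ) q₀ φ δ (bayesConfIntMonitor φ θ δ) := by
  intro C hC x hx
  have := isProbabilityMeasure_matrixBeta (posteriorParam_pos hθ x)
  by_cases hr : Ready θ φ x
  · rw [coverProb_of_semantics_eq_pure _ _ _
      (bayesConfIntMonitor_semantics_of_ready hθ φ δ hx.1 hr),
      posterior_matrixBeta_of_isPath hθ hC hx]
    exact one_sub_le_measure_Icc (memLp_two_eval_of_ready hθ hr) hδ
  · rw [coverProb_of_semantics_eq_pure _ _ _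
      (bayesConfIntMonitor_semantics_of_not_ready hθ φ δ hx.1 hr),
      posterior_matrixBeta_of_isPath hθ hC hx]
    simp [Verdict.toSet, hδ.le]

end ConfInt

end BayesMonitor

open BayesMonitor in
theorem mainTheorem1 {n : ℕ} (θ : Fin (n + 1) → Fin (n + 1) → ℕ) (hθ : ∀ i j, 1 ≤ θ i j)
    (q₀ : Fin (n + 1)) (φ : PSE (Fin (n + 1))) (δ : ℝ) (hδ₀ : 0 < δ) (hδ₁ : δ ≤ 1) :
    IsProbabilityMeasure (matrixBeta θ) ∧
    SolvesBayesianMonitoring (matrixBeta θ) q₀ φ δ (bayesConfIntMonitor φ θ δ) ∧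
    ∀ C : MarkovChain (n + 1), C.StartsAt q₀ → ∀ x : List (Fin (n + 1)), C.IsPath x →
      IsProbabilityMeasure (posterior (matrixBeta θ) q₀ x) ∧
      (¬ Ready θ φ x → (bayesConfIntMonitor φ θ δ).semantics x = PMF.pure none) ∧
      (Ready θ φ x →
        MemLp φ.eval 2 (posterior (matrixBeta θ) q₀ x) ∧
        ∃ E r : ℝ,
          E = ∫ M, φ.eval M ∂(posterior (matrixBeta θ) q₀ x) ∧
          r = √(variance φ.eval (posterior (matrixBeta θ) q₀ x) / δ) ∧
          (bayesConfIntMonitor φ θ δ).semantics x = PMF.pure (some (E - r, E + r)) ∧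
          ENNReal.ofReal (1 - δ) ≤
            posterior (matrixBeta θ) q₀ x {M | φ.eval M ∈ Set.Icc (E - r) (E + r)}) := by
  refine ⟨isProbabilityMeasure_matrixBeta hθ,
    solvesBayesianMonitoring_bayesConfIntMonitor hθ q₀ φ hδ₀, fun C hC x hx => ?_⟩
  rw [posterior_matrixBeta_of_isPath hθ hC hx]
  have hprob := isProbabilityMeasure_matrixBeta (posteriorParam_pos hθ x)
  refine ⟨hprob, bayesConfIntMonitor_semantics_of_not_ready hθ φ δ hx.1, fun hr => ?_⟩
  have hL := memLp_two_eval_of_ready hθ hr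
  exact ⟨hL, _, _, rfl, rfl, bayesConfIntMonitor_semantics_of_ready hθ φ δ hx.1 hr,
    one_sub_le_measure_Icc hL hδ₀⟩
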